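/- Let $a:\mathbb R^d\to\mathbb R$ satisfy $a\ge 0$, $\int_{\mathbb R^d}a(z)\,dz=1$ and $\int_{\mathbb R^d}|z|^2a(z)\,dz<\infty$. Let $(\Omega,\mathcal F,P)$ be a probability space with an ergodic measure preserving dynamical system $\tau_s:\Omega\to\Omega$, $s\in\mathbb R$. Let $\omega\mapsto\mu_\omega(x,y;t)$ be a measurable map from $\Omega$ to $L^\infty(\mathbb R^{2d}\times\mathbb R)$ such that $\mu_\omega$ is periodic in $x$ and in $y$ with period $[0,1)^d$, $0<\alpha_1\le\mu_\omega(x,y;t)\le\alpha_2$ for all $x,y,t,\omega$ with constants $\alpha_1,\alpha_2$, and $\mu_\omega(x,y;t+s)=\mu_{\tau_s\omega}(x,y;t)$. For $\varepsilon>0$ put $$(L^\varepsilon_\omega u)(x,t)=\frac1{\varepsilon^{d+2}}\int_{\mathbb R^d}a\Big(\frac{x-y}\varepsilon\Big)\,\mu_\omega\Big(\frac x\varepsilon,\frac y\varepsilon;\frac t{\varepsilon^2}\Big)\big(u(y,t)-u(x,t)\big)\,dy .$$ Then there are constants $C_1(T)$, $T>0$, and $C_2$ (not depending on $T$), none of them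 depending on $\varepsilon$ or on $\omega$, such that for all $\omega\in\Omega$, $\varepsilon>0$, $T>0$, all real-valued $f\in L^2(0,T;L^2(\mathbb R^d))$ and $g_0\in L^2(\mathbb R^d)$, every solution $\Xi$ of $$\partial_t\Xi-L^\varepsilon_\omega\Xi=f\ \text{ in }\mathbb R^d\times(0,T),\qquad \Xi(\cdot,0)=g_0,$$ satisfies $$\|\Xi\|_{L^\infty(0,T;L^2(\mathbb R^d))}\le C_1(T)\,\|f\|_{L^2(0,T;L^2(\mathbb R^d))}+C_2\,\|g_0\|_{L^2(\mathbb R^d)} .$$ Here a solution is an absolutely continuous function $\Xi:[0,T]\to L^2(\mathbb R^d)$, $\Xi(t)=g_0+\int_0^t\partial_s\Xi(s)\,ds$ with $\partial_t\Xi\in L^1(0,T;L^2(\mathbb R^d))$, for which the equation holds for almost all $t\in(0,T)$ and $x\in\mathbb R^d$. -/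

import Mathlib

open MeasureTheory Set
open scoped NNReal ENNReal

/-- The assumptions on the convolution kernel: `a ≥ 0`, `∫ a = 1` and a finite second moment. -/
structure IsJumpKernel {d : ℕ} (a : EuclideanSpace ℝ (Fin d) → ℝ) : Prop where
  nonneg : ∀ z, 0 ≤ a z
  integrable : Integrable a
  integral_eq_one : ∫ z, a z = 1
  second_moment : Integrable (fun z => ‖z‖ ^ 2 * a z)

/-- An ergodic measure preserving dynamical system `τ s : Ω → Ω`, `s ∈ ℝ`, on a
probability space. -/
structure IsErgodicFlow {Ω : Type*} [MeasurableSpace Ω] (P : Measure Ω) (τ : ℝ → Ω → Ω) :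
    Prop where
  isProbabilityMeasure : IsProbabilityMeasure P
  zero : ∀ ω, τ 0 ω = ω
  add : ∀ s t ω, τ (s + t) ω = τ s (τ t ω)
  measurePreserving : ∀ s, MeasurePreserving (τ s) P P
  ergodic : ∀ A : Set Ω, MeasurableSet A → (∀ s, τ s '' A = A) → P A = 0 ∨ P A = 1

/-- A random coefficient `μ ω x y t`, stationary and ergodic in time, periodic in `x` and `y`,
with `0 < α₁ ≤ μ ≤ α₂`. Every realization is a measurable function of `(x, y, t)`, and
`ω ↦ μ ω`, as a map into `L^∞`, is (weak-star) measurable. Stationarity is an identity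
in `L^∞`. -/
structure IsStationaryErgodicMedium {d : ℕ} {Ω : Type*} [MeasurableSpace Ω] (P : Measure Ω)
    (τ : ℝ → Ω → Ω)
    (μ : Ω → EuclideanSpace ℝ (Fin d) → EuclideanSpace ℝ (Fin d) → ℝ → ℝ) (α₁ α₂ : ℝ) :
    Prop where
  flow : IsErgodicFlow P τ
  measurable_realization : ∀ ω, Measurable
    (fun q : EuclideanSpace ℝ (Fin d) × EuclideanSpace ℝ (Fin d) × ℝ => μ ω q.1 q.2.1 q.2.2)
  measurable_sample : ∀ φ : EuclideanSpace ℝ (Fin d) × EuclideanSpace ℝ (Fin d) × ℝ → ℝ,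
    Integrable φ → Measurable (fun ω => ∫ q, φ q * μ ω q.1 q.2.1 q.2.2)
  periodic_left : ∀ ω x y t (i : Fin d), μ ω (x + EuclideanSpace.single i 1) y t = μ ω x y t
  periodic_right : ∀ ω x y t (i : Fin d), μ ω x (y + EuclideanSpace.single i 1) t = μ ω x y t
  pos : 0 < α₁
  lower : ∀ ω x y t, α₁ ≤ μ ω x y t
  upper : ∀ ω x y t, μ ω x y t ≤ α₂
  stationary : ∀ (s : ℝ) (ω : Ω),
    ∀ᵐ q : EuclideanSpace ℝ (Fin d) × EuclideanSpace ℝ (Fin d) × ℝ,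
      μ ω q.1 q.2.1 (q.2.2 + s) = μ (τ s ω) q.1 q.2.1 q.2.2

/-- For one realization `m` of the coefficient, the operator at time `t`,
`u ↦ ε^{-(d+2)} ∫ a((x-y)/ε) m(x/ε, y/ε; t/ε²) (u(y) - u(x)) dy`. -/
noncomputable def jumpOperator {d : ℕ} (a : EuclideanSpace ℝ (Fin d) → ℝ)
    (m : EuclideanSpace ℝ (Fin d) → EuclideanSpace ℝ (Fin d) → ℝ → ℝ) (ε t : ℝ)
    (u : EuclideanSpace ℝ (Fin d) → ℝ) (x : EuclideanSpace ℝ (Fin d)) : ℝ :=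
  1 / ε ^ (d + 2) *
    ∫ y, a (ε⁻¹ • (x - y)) * m (ε⁻¹ • x) (ε⁻¹ • y) (t / ε ^ 2) * (u y - u x)

/-- `Ξ` solves `∂_t Ξ - L^ε Ξ = f` on `(0,T)` with `Ξ(0) = g₀`: it is absolutely continuous on
`[0,T]` with values in `L²`, with time derivative `D ∈ L¹(0,T;L²)` and initial value `g₀`, and
the equation holds for almost all `t` and `x`. -/
def IsCauchySolution {d : ℕ} (a : EuclideanSpace ℝ (Fin d) → ℝ)
    (m : EuclideanSpace ℝ (Fin d) → EuclideanSpace ℝ (Fin d) → ℝ → ℝ) (ε T : ℝ)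
    (f : ℝ → Lp ℝ 2 (volume : Measure (EuclideanSpace ℝ (Fin d))))
    (g₀ : Lp ℝ 2 (volume : Measure (EuclideanSpace ℝ (Fin d))))
    (Ξ : ℝ → Lp ℝ 2 (volume : Measure (EuclideanSpace ℝ (Fin d)))) : Prop :=
  ∃ D : ℝ → Lp ℝ 2 (volume : Measure (EuclideanSpace ℝ (Fin d))),
    IntegrableOn D (Ioo 0 T) ∧
    (∀ t ∈ Icc 0 T, Ξ t = g₀ + ∫ s in (0 : ℝ)..t, D s) ∧
    ∀ᵐ t ∂(volume.restrict (Ioo 0 T)), ∀ᵐ x : EuclideanSpace ℝ (Fin d),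
      D t x - jumpOperator a m ε t (Ξ t) x = f t x

/-! The kernel is not symmetric, so testing the equation with `Ξ` leaves a growth rate of order
`ε⁻²`. The remedy is to move the weight. For a Markov operator `S`, Jensen gives `|S u|² ≤ S |u|²`,
hence `∫ p |S u|² ≤ ∫ (S* p) |u|²`. With `p = 1` at the final time, transported backward by the dual
evolution, the weighted norms of the homogeneous problem do not grow, and only an upper bound on `p`
is needed (`eLpNorm_withDensity_le_of_steps`).

This bound `M` is uniform in time and in `ε`. After rescaling, `p` is `ℤ^d`-periodic and its mass on
the unit cell does not grow. It is lost at rate at least `α₁ p` and gained at rate at most `α₂`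
times its convolution with the reflected `a`. The periodization of `a` is a bounded function plus
one of small integral, so the gain is at most `α₁ M / 2` plus a multiple of the mass, and a large
`M` is never exceeded (`exists_isPeriodicDensity_dualDensity`). Parabolic scaling transfers `M` from
scale one to every `ε` (`dualDensity_jumpKernel_smul`).

Since the coefficient is only measurable in time, the evolution is compared with explicit Euler
steps whose kernels are integrated over each step. The local errors (`norm_sub_euler_step_le`) add
up to `∫ ‖f‖` plus a term vanishing with the step, so that `‖Ξ t‖ ≤ √M (‖g₀‖ + ∫ ‖f‖)`. -/

/-! ### Sub-Markov kernels, Jensen's inequality and weighted `L²` bounds. -/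

section Kernel

variable {X : Type*} [MeasurableSpace X] {ν : Measure X}

/-- The generator `u ↦ ∫ k(x, y) (u(y) - u(x)) dy` of the jump process with rates `k`. -/
noncomputable def kernelOp (ν : Measure X) (k : X → X → ℝ) (u : X → ℝ) (x : X) : ℝ :=
  ∫ y, k x y * (u y - u x) ∂ν

/-- Nonnegative measurable kernels whose row and column integrals are at most one. -/
structure IsSubMarkov (ν : Measure X) (k : X → X → ℝ) : Prop where
  measurable : Measurable (Function.uncurry k)
  nonneg : ∀ x y, 0 ≤ k x y
  integrable : ∀ x, Integrable (k x) ν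
  row_le : ∀ x, ∫ y, k x y ∂ν ≤ 1
  col_le : ∀ y, ∫⁻ x, ENNReal.ofReal (k x y) ∂ν ≤ 1

/-- The action of the transpose of `1 + kernelOp ν k` on nonnegative densities. -/
noncomputable def dualDensity (ν : Measure X) (k : X → X → ℝ) (p : X → ℝ≥0∞) (y : X) : ℝ≥0∞ :=
  ∫⁻ x, ENNReal.ofReal (k x y) * p x ∂ν + ENNReal.ofReal (1 - ∫ z, k y z ∂ν) * p y

lemma kernelOp_congr_ae (k : X → X → ℝ) {u v : X → ℝ} (h : u =ᵐ[ν] v) :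
    kernelOp ν k u =ᵐ[ν] kernelOp ν k v := by
  filter_upwards [h] with x hx
  refine integral_congr_ae ?_
  filter_upwards [h] with y hy
  rw [hx, hy]

lemma eLpNorm_two_sq {μ : Measure X} (u : X → ℝ) : eLpNorm u 2 μ ^ 2 = ∫⁻ x, ‖u x‖ₑ ^ 2 ∂μ := by
  have := eLpNorm_nnreal_pow_eq_lintegral (f := u) (μ := μ) (p := 2) (by norm_num)
  simpa using this

namespace IsSubMarkov

variable {k : X → X → ℝ}

lemma measurable_row (hk : IsSubMarkov ν k) (x : X) : Measurable (k x) :=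
  hk.measurable.comp measurable_prodMk_left

lemma measurable_rowIntegral [SFinite ν] (hk : IsSubMarkov ν k) :
    Measurable fun x => ∫ y, k x y ∂ν :=
  (hk.measurable.stronglyMeasurable.integral_prod_right).measurable

lemma lintegral_row_le (hk : IsSubMarkov ν k) (x : X) :
    ∫⁻ y, ENNReal.ofReal (k x y) ∂ν ≤ 1 := by
  rw [← ofReal_integral_eq_lintegral_ofReal (hk.integrable x) (ae_of_all _ (hk.nonneg x))]
  exact ENNReal.ofReal_le_one.2 (hk.row_le x)

/-- Square integrability against the row `k x` yields integrability against it. -/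
lemma integrable_mul_of_lintegral_sq_ne_top (hk : IsSubMarkov ν k) {u : X → ℝ} (hu : Measurable u)
    {x : X} (hx : ∫⁻ y, ENNReal.ofReal (k x y) * ‖u y‖ₑ ^ 2 ∂ν ≠ ∞) :
    Integrable (fun y => k x y * u y ^ 2) ν ∧ Integrable (fun y => k x y * u y) ν := by
  have h2 : Integrable (fun y => k x y * u y ^ 2) ν := by
    refine ⟨((hk.measurable_row x).mul (hu.pow_const 2)).aestronglyMeasurable, ?_⟩
    rw [hasFiniteIntegral_iff_enorm]
    refine lt_of_le_of_lt (lintegral_mono fun y => ?_) (lt_top_iff_ne_top.2 hx)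
    rw [enorm_mul, enorm_pow, Real.enorm_of_nonneg (hk.nonneg x y)]
  refine ⟨h2, ((hk.integrable x).add h2).mono'
    ((hk.measurable_row x).mul hu).aestronglyMeasurable (ae_of_all _ fun y => ?_)⟩
  have h0 := hk.nonneg x y
  rw [Real.norm_eq_abs, abs_mul, abs_of_nonneg h0]
  simp only [Pi.add_apply]
  nlinarith [sq_nonneg (|u y| - 1), sq_abs (u y), abs_nonneg (u y)]

/-- Jensen's inequality for the Markov operator `1 + kernelOp ν k`. -/
lemma enorm_add_kernelOp_sq_le (hk : IsSubMarkov ν k) {u : X → ℝ} (hu : Measurable u) (x : X) :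
    ‖u x + kernelOp ν k u x‖ₑ ^ 2 ≤ ENNReal.ofReal (1 - ∫ y, k x y ∂ν) * ‖u x‖ₑ ^ 2 +
      ∫⁻ y, ENNReal.ofReal (k x y) * ‖u y‖ₑ ^ 2 ∂ν := by
  by_cases hx : ∫⁻ y, ENNReal.ofReal (k x y) * ‖u y‖ₑ ^ 2 ∂ν = ∞
  · simp [hx]
  obtain ⟨h2, h1⟩ := hk.integrable_mul_of_lintegral_sq_ne_top hu hx
  have h0 := hk.integrable x
  have hsq : ∀ r : ℝ, ‖r‖ₑ ^ 2 = ENNReal.ofReal (r ^ 2) := fun r => by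
    rw [← enorm_pow, Real.enorm_of_nonneg (sq_nonneg r)]
  have hint : ∫⁻ y, ENNReal.ofReal (k x y) * ‖u y‖ₑ ^ 2 ∂ν
      = ENNReal.ofReal (∫ y, k x y * u y ^ 2 ∂ν) := by
    rw [ofReal_integral_eq_lintegral_ofReal h2
      (ae_of_all _ fun y => mul_nonneg (hk.nonneg x y) (sq_nonneg _))]
    refine lintegral_congr fun y => ?_
    rw [hsq, ENNReal.ofReal_mul (hk.nonneg x y)]
  have hl : 0 ≤ 1 - ∫ y, k x y ∂ν := sub_nonneg.2 (hk.row_le x)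
  rw [hint, hsq, hsq, ← ENNReal.ofReal_mul hl, ← ENNReal.ofReal_add
    (mul_nonneg hl (sq_nonneg _))
    (integral_nonneg fun y => mul_nonneg (hk.nonneg x y) (sq_nonneg _))]
  apply ENNReal.ofReal_le_ofReal
  have hK : kernelOp ν k u x = ∫ y, k x y * u y ∂ν - (∫ y, k x y ∂ν) * u x := by
    rw [kernelOp, ← integral_mul_const, ← integral_sub h1 (h0.mul_const _)]
    exact integral_congr_ae (ae_of_all _ fun y => by ring)
  -- `c` is the mean of `u` under the probability measure `k x · ν + (1 - ∫ k x) δ_x`. The claim is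
  -- that the variance, `hpos` plus `hq`, is nonnegative.
  set c := u x + kernelOp ν k u x with hc
  have hpos : 0 ≤ ∫ y, k x y * (u y - c) ^ 2 ∂ν :=
    integral_nonneg fun y => mul_nonneg (hk.nonneg x y) (sq_nonneg _)
  have hexp : ∫ y, k x y * (u y - c) ^ 2 ∂ν
      = ∫ y, k x y * u y ^ 2 ∂ν - 2 * c * ∫ y, k x y * u y ∂ν + c ^ 2 * ∫ y, k x y ∂ν := by
    have h3 := h1.const_mul (2 * c)
    have h23 : Integrable (fun y => k x y * u y ^ 2 - 2 * c * (k x y * u y)) ν := h2.sub h3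
    rw [← integral_const_mul, ← integral_const_mul,
      ← integral_sub h2 h3, ← integral_add h23 (h0.const_mul _)]
    exact integral_congr_ae (ae_of_all _ fun y => by simp only; ring)
  have hq : 0 ≤ (1 - ∫ y, k x y ∂ν) * (u x - c) ^ 2 := mul_nonneg hl (sq_nonneg _)
  have hI : ∫ y, k x y * u y ∂ν = c - u x + (∫ y, k x y ∂ν) * u x := by
    rw [hc, hK]; ring
  rw [hexp, hI] at hpos
  nlinarith

/-- The argument yields 2; the square 4 gives a numeral as operator bound after taking roots. -/
lemma dualDensity_one_le (hk : IsSubMarkov ν k) (x : X) : dualDensity ν k (fun _ => 1) x ≤ 4 := by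
  simp only [dualDensity, mul_one]
  calc _ ≤ (1 : ℝ≥0∞) + 1 := by
        gcongr
        · exact hk.col_le x
        · exact ENNReal.ofReal_le_one.2
            (by linarith [integral_nonneg (μ := ν) (f := k x) (hk.nonneg x)])
    _ ≤ 4 := by norm_num

variable [SFinite ν]

lemma measurable_dualDensity (hk : IsSubMarkov ν k) {p : X → ℝ≥0∞} (hp : Measurable p) :
    Measurable (dualDensity ν k p) := by
  refine Measurable.add ?_ ((measurable_const.sub hk.measurable_rowIntegral).ennreal_ofReal.mul hp)
  exact Measurable.lintegral_prod_left' (f := fun q : X × X => ENNReal.ofReal (k q.1 q.2) * p q.1)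
    (hk.measurable.ennreal_ofReal.mul (hp.comp measurable_fst))

/-- Jensen at each point, integrated against `p`; Tonelli then moves the averaging from `|u|²` onto
`p`. No symmetry is needed, at the price of a new weight. -/
lemma lintegral_enorm_add_kernelOp_sq_le (hk : IsSubMarkov ν k) {u : X → ℝ} (hu : Measurable u)
    {p : X → ℝ≥0∞} (hp : Measurable p) :
    ∫⁻ x, p x * ‖u x + kernelOp ν k u x‖ₑ ^ 2 ∂ν ≤ ∫⁻ x, dualDensity ν k p x * ‖u x‖ₑ ^ 2 ∂ν := by
  have hm : Measurable fun q : X × X => p q.1 * (ENNReal.ofReal (k q.1 q.2) * ‖u q.2‖ₑ ^ 2) :=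
    (hp.comp measurable_fst).mul
      (hk.measurable.ennreal_ofReal.mul ((hu.comp measurable_snd).enorm.pow_const 2))
  calc
    _ ≤ ∫⁻ x, (ENNReal.ofReal (1 - ∫ y, k x y ∂ν) * p x * ‖u x‖ₑ ^ 2 +
          ∫⁻ y, p x * (ENNReal.ofReal (k x y) * ‖u y‖ₑ ^ 2) ∂ν) ∂ν := by
        refine lintegral_mono fun x => ?_
        refine (mul_le_mul_right (hk.enorm_add_kernelOp_sq_le hu x) (p x)).trans_eq ?_
        rw [mul_add, lintegral_const_mul]
        · ring
        · exact (hk.measurable_row x).ennreal_ofReal.mul (hu.enorm.pow_const 2)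
    _ = ∫⁻ x, ENNReal.ofReal (1 - ∫ y, k x y ∂ν) * p x * ‖u x‖ₑ ^ 2 ∂ν +
          ∫⁻ y, ∫⁻ x, p x * (ENNReal.ofReal (k x y) * ‖u y‖ₑ ^ 2) ∂ν ∂ν := by
        rw [lintegral_add_right _ hm.lintegral_prod_right', lintegral_lintegral_swap hm.aemeasurable]
    _ = _ := by
        rw [← lintegral_add_right _ hm.lintegral_prod_left']
        refine lintegral_congr fun y => ?_
        rw [dualDensity, add_mul, add_comm, ← lintegral_mul_const]
        · congr 1
          exact lintegral_congr fun x => by ring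
        · exact (hk.measurable.comp measurable_prodMk_right).ennreal_ofReal.mul hp

lemma measurable_kernelOp (hk : IsSubMarkov ν k) {u : X → ℝ} (hu : Measurable u) :
    Measurable (kernelOp ν k u) := by
  refine (StronglyMeasurable.integral_prod_right'
    (f := fun q : X × X => k q.1 q.2 * (u q.2 - u q.1)) ?_).measurable
  exact (hk.measurable.mul ((hu.comp measurable_snd).sub
    (hu.comp measurable_fst))).stronglyMeasurable

lemma eLpNorm_add_kernelOp_le (hk : IsSubMarkov ν k) {u : X → ℝ} (hu : Measurable u) :
    eLpNorm (fun x => u x + kernelOp ν k u x) 2 ν ≤ 2 * eLpNorm u 2 ν := by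
  rw [← ENNReal.pow_le_pow_left_iff (n := 2) two_ne_zero, mul_pow, eLpNorm_two_sq, eLpNorm_two_sq]
  have := hk.lintegral_enorm_add_kernelOp_sq_le hu (p := fun _ => 1) measurable_const
  simp only [one_mul] at this
  refine this.trans ((lintegral_mono fun x =>
    mul_le_mul_left (hk.dualDensity_one_le x) (‖u x‖ₑ ^ 2)).trans_eq ?_)
  rw [lintegral_const_mul _ (hu.enorm.pow_const 2)]
  norm_num

lemma eLpNorm_kernelOp_le (hk : IsSubMarkov ν k) {u : X → ℝ} (hu : Measurable u) :
    eLpNorm (kernelOp ν k u) 2 ν ≤ 3 * eLpNorm u 2 ν := by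
  have h : kernelOp ν k u = (fun x => u x + kernelOp ν k u x) - u := by ext; simp
  rw [h]
  refine (eLpNorm_sub_le (hu.add (hk.measurable_kernelOp hu)).aestronglyMeasurable
    hu.aestronglyMeasurable (by norm_num)).trans ?_
  refine (add_le_add_left (hk.eLpNorm_add_kernelOp_le hu) _).trans_eq ?_
  ring

lemma memLp_kernelOp (hk : IsSubMarkov ν k) {u : X → ℝ} (hu : Measurable u) (h2 : MemLp u 2 ν) :
    MemLp (kernelOp ν k u) 2 ν :=
  ⟨(hk.measurable_kernelOp hu).aestronglyMeasurable, (hk.eLpNorm_kernelOp_le hu).trans_lt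
    (ENNReal.mul_lt_top (by norm_num) h2.2)⟩

lemma lintegral_lintegral_sq_le (hk : IsSubMarkov ν k) {u : X → ℝ} (hu : Measurable u) :
    ∫⁻ x, ∫⁻ y, ENNReal.ofReal (k x y) * ‖u y‖ₑ ^ 2 ∂ν ∂ν ≤ ∫⁻ y, ‖u y‖ₑ ^ 2 ∂ν := by
  rw [lintegral_lintegral_swap]
  · refine lintegral_mono fun y => ?_
    have hm : Measurable fun x => ENNReal.ofReal (k x y) :=
      (hk.measurable.comp measurable_prodMk_right).ennreal_ofReal
    rw [lintegral_mul_const _ hm]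
    exact (mul_le_mul_left (hk.col_le y) _).trans_eq (one_mul _)
  · exact (hk.measurable.ennreal_ofReal.mul
      ((hu.comp measurable_snd).enorm.pow_const 2)).aemeasurable

lemma ae_integrable_mul (hk : IsSubMarkov ν k) {u : X → ℝ} (hu : Measurable u)
    (h2 : MemLp u 2 ν) : ∀ᵐ x ∂ν, Integrable (fun y => k x y * u y) ν := by
  have hm : Measurable fun q : X × X => ENNReal.ofReal (k q.1 q.2) * ‖u q.2‖ₑ ^ 2 :=
    hk.measurable.ennreal_ofReal.mul ((hu.comp measurable_snd).enorm.pow_const 2)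
  have hfin : ∫⁻ x, ∫⁻ y, ENNReal.ofReal (k x y) * ‖u y‖ₑ ^ 2 ∂ν ∂ν ≠ ∞ := by
    refine ((hk.lintegral_lintegral_sq_le hu).trans_lt ?_).ne
    rw [← eLpNorm_two_sq]
    exact ENNReal.pow_lt_top h2.2
  filter_upwards [ae_lt_top hm.lintegral_prod_right' hfin] with x hx
  exact (hk.integrable_mul_of_lintegral_sq_ne_top hu hx.ne).2

/-- `kernelOp` as a linear operator on `L²`. -/
noncomputable def toLinearMap (hk : IsSubMarkov ν k) : Lp ℝ 2 ν →ₗ[ℝ] Lp ℝ 2 ν :=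
  have hm (u : Lp ℝ 2 ν) : Measurable u := (Lp.stronglyMeasurable u).measurable
  { toFun := fun u => (hk.memLp_kernelOp (hm u) (Lp.memLp u)).toLp
    map_add' := fun u v => by
      rw [← MemLp.toLp_add, MemLp.toLp_eq_toLp_iff]
      refine (kernelOp_congr_ae k (Lp.coeFn_add u v)).trans ?_
      filter_upwards [hk.ae_integrable_mul (hm u) (Lp.memLp u),
        hk.ae_integrable_mul (hm v) (Lp.memLp v)] with x hu hv
      have hx := hk.integrable x
      simp only [kernelOp, Pi.add_apply, mul_sub]
      rw [integral_sub hu (hx.mul_const _), integral_sub hv (hx.mul_const _),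
        integral_sub _ (hx.mul_const _)]
      · simp only [mul_add]
        rw [integral_add hu hv, integral_add (hx.mul_const _) (hx.mul_const _)]
        ring
      · simp only [mul_add]
        exact hu.add hv
    map_smul' := fun c u => by
      rw [RingHom.id_apply, ← MemLp.toLp_const_smul, MemLp.toLp_eq_toLp_iff]
      refine (kernelOp_congr_ae k (Lp.coeFn_smul c u)).trans (ae_of_all _ fun x => ?_)
      simp only [kernelOp, Pi.smul_apply, smul_eq_mul]
      rw [← integral_const_mul]
      exact integral_congr_ae (ae_of_all _ fun y => by ring) }

lemma norm_toLinearMap_apply_le (hk : IsSubMarkov ν k) (u : Lp ℝ 2 ν) :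
    ‖hk.toLinearMap u‖ ≤ 3 * ‖u‖ := by
  simp only [toLinearMap, LinearMap.coe_mk, AddHom.coe_mk, Lp.norm_toLp]
  refine ENNReal.toReal_le_of_le_ofReal (by positivity) ?_
  refine (hk.eLpNorm_kernelOp_le (Lp.stronglyMeasurable u).measurable).trans_eq ?_
  rw [ENNReal.ofReal_mul (by norm_num), ofReal_norm, Lp.enorm_def]
  norm_num

/-- `kernelOp` as a bounded operator on `L²`. -/
noncomputable def toCLM (hk : IsSubMarkov ν k) : Lp ℝ 2 ν →L[ℝ] Lp ℝ 2 ν :=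
  hk.toLinearMap.mkContinuous 3 hk.norm_toLinearMap_apply_le

lemma coeFn_toCLM (hk : IsSubMarkov ν k) (u : Lp ℝ 2 ν) : hk.toCLM u =ᵐ[ν] kernelOp ν k u :=
  MemLp.coeFn_toLp (hk.memLp_kernelOp (Lp.stronglyMeasurable u).measurable (Lp.memLp u))

lemma norm_toCLM_apply_le (hk : IsSubMarkov ν k) (u : Lp ℝ 2 ν) : ‖hk.toCLM u‖ ≤ 3 * ‖u‖ :=
  hk.norm_toLinearMap_apply_le u

/-- The constant is exactly one, so iterating over arbitrarily many steps costs nothing beyond the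
change of weight. -/
lemma eLpNorm_withDensity_add_toCLM_le (hk : IsSubMarkov ν k) {p : X → ℝ≥0∞} (hp : Measurable p)
    (u : Lp ℝ 2 ν) :
    eLpNorm ⇑(u + hk.toCLM u) 2 (ν.withDensity p) ≤
      eLpNorm u 2 (ν.withDensity (dualDensity ν k p)) := by
  have hu : Measurable u := (Lp.stronglyMeasurable u).measurable
  have h : ⇑(u + hk.toCLM u) =ᵐ[ν] fun x => u x + kernelOp ν k u x := by
    filter_upwards [Lp.coeFn_add u (hk.toCLM u), hk.coeFn_toCLM u] with x h1 h2
    rw [h1, Pi.add_apply, h2]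
  have hQ : Measurable fun x => ‖u x + kernelOp ν k u x‖ₑ ^ 2 :=
    (hu.add (hk.measurable_kernelOp hu)).enorm.pow_const 2
  rw [eLpNorm_congr_ae ((withDensity_absolutelyContinuous ν p).ae_eq h),
    ← ENNReal.pow_le_pow_left_iff (n := 2) two_ne_zero, eLpNorm_two_sq, eLpNorm_two_sq,
    lintegral_withDensity_eq_lintegral_mul _ hp hQ,
    lintegral_withDensity_eq_lintegral_mul _ (hk.measurable_dualDensity hp) (hu.enorm.pow_const 2)]
  exact hk.lintegral_enorm_add_kernelOp_sq_le hu hp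

end IsSubMarkov

lemma eLpNorm_withDensity_le {p : X → ℝ≥0∞} {M : ℝ≥0} (hM : ∀ x, p x ≤ M) (u : Lp ℝ 2 ν) :
    eLpNorm u 2 (ν.withDensity p) ≤ NNReal.sqrt M * ‖u‖ₑ := by
  have hle : ν.withDensity p ≤ (M : ℝ≥0∞) • ν := by
    rw [← withDensity_const]
    exact withDensity_mono (ae_of_all _ hM)
  refine (eLpNorm_mono_measure _ hle).trans ?_
  rw [← ENNReal.pow_le_pow_left_iff (n := 2) two_ne_zero, mul_pow, eLpNorm_two_sq,
    lintegral_smul_measure, ← eLpNorm_two_sq, Lp.enorm_def, ← ENNReal.coe_pow,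
    NNReal.sq_sqrt]
  rfl

/-- A perturbed product of Markov operators is bounded on weighted `L²` spaces, as soon as the
weights stay bounded under the dual evolution. -/
lemma eLpNorm_withDensity_le_of_steps [SFinite ν] {M : ℝ≥0} {Good : (X → ℝ≥0∞) → Prop}
    (hmeas : ∀ p, Good p → Measurable p) (hM : ∀ p, Good p → ∀ x, p x ≤ M)
    {k : ℕ → X → X → ℝ} (hk : ∀ i, IsSubMarkov ν (k i))
    (hGood : ∀ i p, Good p → Good (dualDensity ν (k i) p)) (u : ℕ → Lp ℝ 2 ν) (n : ℕ)
    {p : X → ℝ≥0∞} (hp : Good p) :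
    eLpNorm (u n) 2 (ν.withDensity p) ≤ NNReal.sqrt M *
      (‖u 0‖ₑ + ∑ i ∈ Finset.range n, ‖u (i + 1) - (u i + (hk i).toCLM (u i))‖ₑ) := by
  -- The weight varies along the induction: removing the last step replaces `p` by its dual image,
  -- still in `Good`, while each defect is measured at once with the bound `M`.
  induction n generalizing p with
  | zero => simpa using eLpNorm_withDensity_le (hM p hp) (u 0)
  | succ n ih =>
    set v := u n + (hk n).toCLM (u n)
    have hac := withDensity_absolutelyContinuous ν p
    have h : ⇑(u (n + 1)) =ᵐ[ν] ⇑v + ⇑(u (n + 1) - v) := by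
      rw [← (sub_add_cancel (u (n + 1)) v)]
      filter_upwards [Lp.coeFn_add (u (n + 1) - v) v] with x hx
      rw [hx]
      simp [add_comm]
    rw [eLpNorm_congr_ae (hac.ae_eq h), Finset.sum_range_succ, ← add_assoc, mul_add]
    refine (eLpNorm_add_le (Lp.stronglyMeasurable _).aestronglyMeasurable
      (Lp.stronglyMeasurable _).aestronglyMeasurable (by norm_num)).trans (add_le_add ?_ ?_)
    · exact ((hk n).eLpNorm_withDensity_add_toCLM_le (hmeas p hp) (u n)).trans (ih (hGood n p hp))
    · exact eLpNorm_withDensity_le (hM p hp) _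

end Kernel

/-! ### Periodic densities and their invariant supremum bound. -/

section Periodic

variable {E : Type*} [AddCommGroup E] [MeasurableSpace E] [MeasurableAdd₂ E] [MeasurableNeg E]
  {ν : Measure E} {L : AddSubgroup E} {F : Set E}

/-- Densities which are periodic with respect to `L`, bounded by `M`, and have at most the
mass of the constant density `1` on the fundamental cell `F`. -/
structure IsPeriodicDensity (ν : Measure E) (L : AddSubgroup E) (F : Set E) (M : ℝ≥0)
    (q : E → ℝ≥0∞) : Prop where
  measurable : Measurable q
  periodic : ∀ (g : L) (x : E), q (g + x) = q x
  mass_le : ∫⁻ x in F, q x ∂ν ≤ ν F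
  le_bound : ∀ x, q x ≤ M

variable [SFinite ν] [ν.IsAddLeftInvariant] [Countable L]

lemma lintegral_eq_tsum_cell (hF : IsAddFundamentalDomain L F ν) (f : E → ℝ≥0∞) :
    ∫⁻ x, f x ∂ν = ∑' g : L, ∫⁻ x in F, f (g + x) ∂ν :=
  hF.lintegral_eq_tsum'' f

/-- Conservation of mass for the transpose of a periodic kernel. -/
lemma setLIntegral_lintegral_mul_eq (hF : IsAddFundamentalDomain L F ν) {κ : E → E → ℝ≥0∞}
    (hκ : Measurable (Function.uncurry κ)) (hinv : ∀ (g : L) (x y : E), κ (g + x) (g + y) = κ x y)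
    {q : E → ℝ≥0∞} (hq : Measurable q) (hper : ∀ (g : L) (x : E), q (g + x) = q x) :
    ∫⁻ y in F, ∫⁻ x, κ x y * q x ∂ν ∂ν = ∫⁻ x in F, (∫⁻ y, κ x y ∂ν) * q x ∂ν := by
  have hm : ∀ g : E, Measurable fun z : E × E => κ z.1 (g + z.2) * q z.1 := fun g =>
    (hκ.comp (measurable_fst.prodMk (measurable_snd.const_add g))).mul (hq.comp measurable_fst)
  have hm' : ∀ g : E, Measurable fun z : E × E => κ (g + z.2) z.1 * q z.2 := fun g =>
    (hκ.comp ((measurable_snd.const_add g).prodMk measurable_fst)).mul (hq.comp measurable_snd)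
  -- Shifting both variables by `-g` trades a translation of `x` for one of `y`; summation over the
  -- lattice then absorbs the sign.
  have hswap : ∀ g : L, ∫⁻ y in F, ∫⁻ x in F, κ (g + x) y * q x ∂ν ∂ν
      = ∫⁻ x in F, ∫⁻ y in F, κ x (-g + y) * q x ∂ν ∂ν := fun g => by
    rw [lintegral_lintegral_swap (hm' g).aemeasurable]
    refine lintegral_congr fun x => lintegral_congr fun y => ?_
    rw [← hinv (-g) (g + x) y]
    simp
  calc _ = ∫⁻ y in F, ∑' g : L, ∫⁻ x in F, κ (g + x) y * q x ∂ν ∂ν := by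
        refine lintegral_congr fun y => ?_
        rw [lintegral_eq_tsum_cell hF]
        simp only [hper]
    _ = ∑' g : L, ∫⁻ y in F, ∫⁻ x in F, κ (g + x) y * q x ∂ν ∂ν :=
        lintegral_tsum fun g => ((hm' g).lintegral_prod_right').aemeasurable
    _ = ∑' g : L, ∫⁻ x in F, ∫⁻ y in F, κ x (-g + y) * q x ∂ν ∂ν := tsum_congr hswap
    _ = ∑' g : L, ∫⁻ x in F, ∫⁻ y in F, κ x (g + y) * q x ∂ν ∂ν :=
        (Equiv.neg L).tsum_eq (fun g : L => ∫⁻ x in F, ∫⁻ y in F, κ x (g + y) * q x ∂ν ∂ν)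
    _ = ∫⁻ x in F, ∑' g : L, ∫⁻ y in F, κ x (g + y) * q x ∂ν ∂ν :=
        (lintegral_tsum fun g : L => ((hm g).lintegral_prod_right').aemeasurable).symm
    _ = _ := by
        refine lintegral_congr fun x => ?_
        have hx : Measurable (κ x) := hκ.comp measurable_prodMk_left
        rw [← lintegral_mul_const _ hx, lintegral_eq_tsum_cell hF]

/-- Integration over a cell is invariant under translations, for periodic functions. -/
lemma setLIntegral_sub_eq (hF : IsAddFundamentalDomain L F ν) {H : E → ℝ≥0∞}
    (hper : ∀ (g : L) (x : E), H (g + x) = H x) (y : E) :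
    ∫⁻ x in F, H (x - y) ∂ν = ∫⁻ x in F, H x ∂ν := by
  have h := (measurePreserving_vadd (-y) ν).setLIntegral_comp_emb
    (measurableEmbedding_const_vadd (-y)) H F
  -- The translated cell is again a fundamental domain.
  rw [← (hF.vadd_of_comm (-y)).setLIntegral_eq hF H hper, ← image_vadd, ← h]
  exact lintegral_congr fun x => by rw [vadd_eq_add, sub_eq_neg_add]

/-- An integrable convolution kernel acts on bounded periodic densities, up to a small multiple of
the supremum, like a bounded one: truncate its periodization. -/
lemma exists_lintegral_mul_le (hF : IsAddFundamentalDomain L F ν) {b : E → ℝ≥0∞}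
    (hb : Measurable b) (hb1 : ∫⁻ z, b z ∂ν ≠ ∞) {δ : ℝ≥0∞} (hδ : 0 < δ) :
    ∃ K : ℝ≥0, ∀ (M : ℝ≥0∞) (q : E → ℝ≥0∞), Measurable q → (∀ (g : L) (x : E), q (g + x) = q x) →
      (∀ x, q x ≤ M) → ∀ y, ∫⁻ x, b (x - y) * q x ∂ν ≤ δ * M + K * ∫⁻ x in F, q x ∂ν := by
  set A : E → ℝ≥0∞ := fun z => ∑' g : L, b (g + z)
  have hA : Measurable A := Measurable.tsum fun g => hb.comp (measurable_const_add _)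
  have hAper : ∀ (g : L) (x : E), A (g + x) = A x := fun g x => by
    refine Eq.trans (tsum_congr fun g' => ?_)
      ((Equiv.addRight g).tsum_eq fun g' : L => b (g' + x))
    simp [add_assoc]
  have hAint : ∫⁻ x in F, A x ∂ν ≠ ∞ := by
    have hbg : ∀ g : L, AEMeasurable (fun x => b (g + x)) (ν.restrict F) := fun g =>
      (hb.comp (measurable_const_add (g : E))).aemeasurable
    rwa [lintegral_tsum hbg, ← lintegral_eq_tsum_cell hF]
  -- `A` is the periodization of `b`, integrable on the cell but possibly unbounded. `H n` keeps its
  -- values above `n`; its integral tends to zero, and the rest is at most `n`, which becomes `K`.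
  set H : ℕ → E → ℝ≥0∞ := fun n => {z | (n : ℝ≥0∞) < A z}.indicator A
  have hH : ∀ n, Measurable (H n) := fun n => hA.indicator (measurableSet_lt measurable_const hA)
  have hlim : Filter.Tendsto (fun n => ∫⁻ x in F, H n x ∂ν) Filter.atTop (nhds 0) := by
    have := tendsto_lintegral_of_dominated_convergence (μ := ν.restrict F) (F := H)
      (f := fun _ => 0) A hH (fun n => ae_of_all _ fun x => indicator_le_self _ _ x) hAint (by
        filter_upwards [ae_lt_top hA hAint] with x hx
        obtain ⟨N, hN⟩ := ENNReal.exists_nat_gt hx.ne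
        refine tendsto_const_nhds.congr' ?_
        filter_upwards [Filter.eventually_ge_atTop N] with n hn
        refine (indicator_of_notMem ?_ _).symm
        simp only [mem_ofPred_eq, not_lt]
        exact hN.le.trans (by exact_mod_cast hn))
    simpa using this
  obtain ⟨n, hn⟩ := (hlim.eventually_lt_const hδ).exists
  refine ⟨n, fun M q hq hqper hqM y => ?_⟩
  have hHper : ∀ (g : L) (x : E), H n (g + x) = H n x := fun g x => by
    simp only [H, indicator_apply, mem_ofPred_eq, hAper]
  have hAH : ∀ z, A z ≤ H n z + n := fun z => by
    by_cases hz : (n : ℝ≥0∞) < A z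
    · exact (indicator_of_mem (s := {z | (n : ℝ≥0∞) < A z}) hz A).ge.trans le_self_add
    · exact (not_lt.1 hz).trans le_add_self
  have hbm : ∀ g : E, Measurable fun x => b (g + (x - y)) * q x := fun g =>
    (hb.comp ((measurable_id.sub_const y).const_add g)).mul hq
  calc ∫⁻ x, b (x - y) * q x ∂ν = ∫⁻ x in F, A (x - y) * q x ∂ν := by
        rw [lintegral_eq_tsum_cell hF]
        simp only [hqper, add_sub_assoc]
        rw [← lintegral_tsum fun g : L => (hbm g).aemeasurable]
        exact lintegral_congr fun x => ENNReal.tsum_mul_right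
    _ ≤ ∫⁻ x in F, (M * H n (x - y) + n * q x) ∂ν := by
        refine lintegral_mono fun x => ?_
        calc A (x - y) * q x ≤ (H n (x - y) + n) * q x := mul_le_mul_left (hAH _) _
          _ = q x * H n (x - y) + n * q x := by ring
          _ ≤ _ := by gcongr; exact hqM x
    _ = M * ∫⁻ x in F, H n x ∂ν + n * ∫⁻ x in F, q x ∂ν := by
        have hHy : Measurable fun x => H n (x - y) := (hH n).comp (measurable_id.sub_const y)
        rw [lintegral_add_right _ (hq.const_mul _), lintegral_const_mul _ hq,
          lintegral_const_mul _ hHy,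
          setLIntegral_sub_eq hF hHper]
    _ ≤ _ := by
        rw [mul_comm M]
        gcongr
        simp

/-- The transpose of a periodic Markov operator, comparable to a fixed convolution, preserves
a class of bounded periodic densities. -/
lemma exists_isPeriodicDensity_dualDensity (hF : IsAddFundamentalDomain L F ν) (hV : ν F ≠ ∞)
    {b : E → ℝ} (hb : Measurable b) (hbi : Integrable b ν) {α₁ α₂ : ℝ}
    (h1 : 0 < α₁) (h2 : 0 < α₂) :
    ∃ M : ℝ≥0, 1 ≤ M ∧ ∀ (k : E → E → ℝ) (h : ℝ), 0 ≤ h → IsSubMarkov ν k →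
      (∀ (g : L) (x y : E), k (g + x) (g + y) = k x y) →
      (∀ x y, k x y ≤ h * α₂ * b (x - y)) → (∀ x, h * α₁ ≤ ∫ y, k x y ∂ν) →
      ∀ q, IsPeriodicDensity ν L F M q → IsPeriodicDensity ν L F M (dualDensity ν k q) := by
  obtain ⟨K, hK⟩ := exists_lintegral_mul_le hF hb.ennreal_ofReal hbi.lintegral_lt_top.ne
    -- With this `δ` the gain from the unbounded part is at most `h α₁ M / 2`, half of the
    -- guaranteed loss at height `M`.
    (δ := ENNReal.ofReal (α₁ / (2 * α₂))) (ENNReal.ofReal_pos.2 (by positivity))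
  set V := (ν F).toReal
  have hV0 : 0 ≤ V := ENNReal.toReal_nonneg
  have hMnn : (0 : ℝ) ≤ 2 * α₂ * K * V / α₁ := by positivity
  -- The other half of the loss, `h α₁ M / 2`, must pay for the gain `h α₂ K V` from the mass. The
  -- summand 1 admits the constant density 1.
  set M : ℝ≥0 := 1 + (2 * α₂ * K * V / α₁).toNNReal
  have hMr : (M : ℝ) = 1 + 2 * α₂ * K * V / α₁ := by simp [M, Real.coe_toNNReal _ hMnn]
  refine ⟨M, le_self_add, fun k h hh hk hinv hle hge q hq => ?_⟩
  have hrowinv : ∀ (g : L) (x : E), ∫ z, k (g + x) z ∂ν = ∫ z, k x z ∂ν := fun g x => by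
    rw [← integral_add_left_eq_self (μ := ν) (k (g + x)) (g : E)]
    simp only [hinv]
  refine ⟨hk.measurable_dualDensity hq.measurable, fun g y => ?_, ?_, fun y => ?_⟩
  · rw [dualDensity, dualDensity, hrowinv, hq.periodic,
      ← lintegral_add_left_eq_self (μ := ν) _ (g : E)]
    simp only [hinv, hq.periodic]
  · have hlam : Measurable fun y => ENNReal.ofReal (1 - ∫ z, k y z ∂ν) * q y :=
      (measurable_const.sub hk.measurable_rowIntegral).ennreal_ofReal.mul hq.measurable
    simp only [dualDensity]
    rw [lintegral_add_right _ hlam, setLIntegral_lintegral_mul_eq hF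
      (κ := fun x y => ENNReal.ofReal (k x y)) hk.measurable.ennreal_ofReal
      (fun g x y => by rw [hinv]) hq.measurable hq.periodic,
      ← lintegral_add_right _ hlam]
    refine le_trans (lintegral_mono fun x => ?_) hq.mass_le
    rw [← ofReal_integral_eq_lintegral_ofReal (hk.integrable x) (ae_of_all _ (hk.nonneg x)),
      ← add_mul, ← ENNReal.ofReal_add (integral_nonneg (hk.nonneg x))
        (sub_nonneg.2 (hk.row_le x))]
    simp
  · have hα : h * α₁ ≤ 1 := (hge y).trans (hk.row_le y)
    have hbd := hK M q hq.measurable hq.periodic hq.le_bound y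
    have hbm : Measurable fun x => ENNReal.ofReal (b (x - y)) * q x :=
      (hb.comp (measurable_id.sub_const y)).ennreal_ofReal.mul hq.measurable
    calc dualDensity ν k q y
        ≤ ENNReal.ofReal (h * α₂) * ∫⁻ x, ENNReal.ofReal (b (x - y)) * q x ∂ν +
          ENNReal.ofReal (1 - h * α₁) * M := by
          refine add_le_add ?_ (mul_le_mul' (ENNReal.ofReal_le_ofReal ?_) (hq.le_bound y))
          · rw [← lintegral_const_mul _ hbm]
            refine lintegral_mono fun x => ?_
            rw [← mul_assoc, ← ENNReal.ofReal_mul (by positivity)]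
            exact mul_le_mul_left (ENNReal.ofReal_le_ofReal (hle x y)) _
          · linarith [hge y]
      _ ≤ ENNReal.ofReal (h * α₂) * (ENNReal.ofReal (α₁ / (2 * α₂)) * M + K * ν F) +
          ENNReal.ofReal (1 - h * α₁) * M := by
          gcongr
          exact hbd.trans (by gcongr; exact hq.mass_le)
      _ = ENNReal.ofReal (h * α₂ * (α₁ / (2 * α₂) * M + K * V) + (1 - h * α₁) * M) := by
          have e1 : (M : ℝ≥0∞) = ENNReal.ofReal M := ENNReal.ofReal_coe_nnreal.symm
          have e2 : (K : ℝ≥0∞) = ENNReal.ofReal K := ENNReal.ofReal_coe_nnreal.symm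
          have hα' : 0 ≤ 1 - h * α₁ := by linarith
          rw [← ENNReal.ofReal_toReal hV, e1, e2, ← ENNReal.ofReal_mul (by positivity),
            ← ENNReal.ofReal_mul (by positivity), ← ENNReal.ofReal_add (by positivity)
            (by positivity), ← ENNReal.ofReal_mul (by positivity), ← ENNReal.ofReal_mul hα',
            ← ENNReal.ofReal_add (by positivity) (by positivity)]
      _ ≤ M := by
          rw [← ENNReal.ofReal_coe_nnreal]
          refine ENNReal.ofReal_le_ofReal ?_
          have : h * α₂ * (α₁ / (2 * α₂) * M + K * V) + (1 - h * α₁) * M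
              = M - h * α₁ / 2 := by
            rw [hMr]
            field_simp
            ring
          rw [this]
          have : 0 ≤ h * α₁ := by positivity
          linarith

end Periodic

/-! ### Jump kernels at scale `ε` and reduction to scale one. -/

section Scaling

variable {d : ℕ}

local notation "𝔼" d => EuclideanSpace ℝ (Fin d)

/-- The jump kernel `ε^{-(d+2)} a((x-y)/ε) w(x/ε, y/ε)`. -/
noncomputable def jumpKernel (a : (𝔼 d) → ℝ) (w : (𝔼 d) → (𝔼 d) → ℝ) (ε : ℝ) (x y : 𝔼 d) : ℝ :=
  1 / ε ^ (d + 2) * (a (ε⁻¹ • (x - y)) * w (ε⁻¹ • x) (ε⁻¹ • y))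

lemma jumpOperator_eq_kernelOp (a : (𝔼 d) → ℝ) (m : (𝔼 d) → (𝔼 d) → ℝ → ℝ) (ε t : ℝ)
    (u : (𝔼 d) → ℝ) :
    jumpOperator a m ε t u = kernelOp volume (jumpKernel a (fun x y => m x y (t / ε ^ 2)) ε) u := by
  ext x
  rw [jumpOperator, kernelOp, ← integral_const_mul]
  simp only [jumpKernel, mul_assoc]

/-- Holds at every `x`, because `y ↦ ε⁻¹ • (x - y)` pulls null sets back to null sets. It permits a
Borel representative of `a`. -/
lemma jumpOperator_congr_ae {a a' : (𝔼 d) → ℝ} (h : a =ᵐ[volume] a')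
    (m : (𝔼 d) → (𝔼 d) → ℝ → ℝ) {ε : ℝ} (hε : 0 < ε) (t : ℝ) (u : (𝔼 d) → ℝ) (x : 𝔼 d) :
    jumpOperator a m ε t u x = jumpOperator a' m ε t u x := by
  have h1 : (fun z : 𝔼 d => a (ε⁻¹ • z)) =ᵐ[volume] fun z => a' (ε⁻¹ • z) :=
    (Measure.quasiMeasurePreserving_smul volume (inv_ne_zero hε.ne')).ae_eq_comp h
  have h2 := (Measure.measurePreserving_sub_left volume x).quasiMeasurePreserving.ae_eq_comp h1
  rw [jumpOperator, jumpOperator]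
  congr 1
  refine integral_congr_ae ?_
  filter_upwards [h2] with y hy
  simp only [Function.comp_apply] at hy
  rw [hy]

lemma lintegral_eq_mul_lintegral_comp_smul {ε : ℝ} (hε : 0 < ε) (f : (𝔼 d) → ℝ≥0∞) :
    ∫⁻ x, f x = ENNReal.ofReal (ε ^ d) * ∫⁻ x, f (ε • x) := by
  have he : MeasurableEmbedding fun x : 𝔼 d => ε • x :=
    (Homeomorph.smulOfNeZero ε hε.ne').measurableEmbedding
  have hpos : 0 < ε ^ d := pow_pos hε d
  rw [← he.lintegral_map, Measure.map_addHaar_smul volume hε.ne', lintegral_smul_measure,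
    finrank_euclideanSpace, Fintype.card_fin, abs_of_pos (inv_pos.2 hpos), smul_eq_mul, ← mul_assoc,
    ← ENNReal.ofReal_mul hpos.le, mul_inv_cancel₀ hpos.ne', ENNReal.ofReal_one, one_mul]

lemma pow_mul_jumpKernel_smul (a : (𝔼 d) → ℝ) (w : (𝔼 d) → (𝔼 d) → ℝ) {ε : ℝ} (hε : 0 < ε)
    (x y : 𝔼 d) :
    ε ^ d * jumpKernel a w ε (ε • x) (ε • y) =
      jumpKernel a (fun x y => (ε ^ 2)⁻¹ * w x y) 1 x y := by
  simp only [jumpKernel, ← smul_sub, smul_smul, inv_mul_cancel₀ hε.ne', one_smul, inv_one,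
    one_pow, div_one, one_mul]
  field_simp
  ring

variable {a : (𝔼 d) → ℝ}

lemma integrable_comp_sub_smul (hai : Integrable a) {ε : ℝ} (hε : 0 < ε) (x : 𝔼 d) :
    Integrable fun y => a (ε⁻¹ • (x - y)) :=
  (hai.comp_smul (inv_ne_zero hε.ne')).comp_sub_left x

lemma integrable_comp_sub_smul' (hai : Integrable a) {ε : ℝ} (hε : 0 < ε) (y : 𝔼 d) :
    Integrable fun x => a (ε⁻¹ • (x - y)) :=
  (hai.comp_smul (inv_ne_zero hε.ne')).comp_sub_right y

lemma integral_comp_inv_smul_eq (ha1 : ∫ z, a z = 1) {ε : ℝ} (hε : 0 < ε) :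
    1 / ε ^ (d + 2) * ∫ z, a (ε⁻¹ • z) = (ε ^ 2)⁻¹ := by
  rw [Measure.integral_comp_inv_smul_of_nonneg volume a hε.le, ha1, finrank_euclideanSpace,
    Fintype.card_fin, smul_eq_mul, mul_one, pow_add]
  field_simp

lemma measurable_jumpKernel (ham : Measurable a) {w : (𝔼 d) → (𝔼 d) → ℝ}
    (hw : Measurable (Function.uncurry w)) (ε : ℝ) :
    Measurable (Function.uncurry (jumpKernel a w ε)) := by
  refine Measurable.const_mul (Measurable.mul ?_ ?_) _
  · exact ham.comp (f := fun q : (𝔼 d) × (𝔼 d) => ε⁻¹ • (q.1 - q.2)) (by fun_prop)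
  · exact hw.comp (f := fun q : (𝔼 d) × (𝔼 d) => (ε⁻¹ • q.1, ε⁻¹ • q.2)) (by fun_prop)

/-- The prefactor and the Jacobian leave `ε⁻²` times a bound for `w`, so `w ≤ ε²` is what keeps the
row and column masses below one. -/
lemma isSubMarkov_jumpKernel (ham : Measurable a) (ha0 : ∀ z, 0 ≤ a z) (hai : Integrable a)
    (ha1 : ∫ z, a z = 1) {w : (𝔼 d) → (𝔼 d) → ℝ} (hw : Measurable (Function.uncurry w))
    (hw0 : ∀ x y, 0 ≤ w x y) {ε : ℝ} (hε : 0 < ε) (hwε : ∀ x y, w x y ≤ ε ^ 2) :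
    IsSubMarkov volume (jumpKernel a w ε) := by
  have hm := measurable_jumpKernel ham hw ε
  have h0 : ∀ x y, 0 ≤ jumpKernel a w ε x y := fun x y =>
    mul_nonneg (by positivity) (mul_nonneg (ha0 _) (hw0 _ _))
  have hle : ∀ x y, jumpKernel a w ε x y ≤ 1 / ε ^ (d + 2) * (a (ε⁻¹ • (x - y)) * ε ^ 2) :=
    fun x y => mul_le_mul_of_nonneg_left (mul_le_mul_of_nonneg_left (hwε _ _) (ha0 _))
      (by positivity)
  have hB : ∀ x, Integrable fun y => 1 / ε ^ (d + 2) * (a (ε⁻¹ • (x - y)) * ε ^ 2) := fun x =>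
    ((integrable_comp_sub_smul hai hε x).mul_const _).const_mul _
  have hB' : ∀ y, Integrable fun x => 1 / ε ^ (d + 2) * (a (ε⁻¹ • (x - y)) * ε ^ 2) := fun y =>
    ((integrable_comp_sub_smul' hai hε y).mul_const _).const_mul _
  have hone : 1 / ε ^ (d + 2) * ((∫ z, a (ε⁻¹ • z)) * ε ^ 2) = 1 := by
    rw [← mul_assoc, integral_comp_inv_smul_eq ha1 hε, inv_mul_cancel₀ (by positivity)]
  have hint : ∀ x, Integrable (jumpKernel a w ε x) := fun x =>
    (hB x).mono' (hm.comp measurable_prodMk_left).aestronglyMeasurable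
      (ae_of_all _ fun y => by rw [Real.norm_of_nonneg (h0 x y)]; exact hle x y)
  refine ⟨hm, h0, hint, fun x => ?_, fun y => ?_⟩
  · refine (integral_mono (hint x) (hB x) (hle x)).trans_eq ?_
    rw [integral_const_mul, integral_mul_const,
      integral_sub_left_eq_self (fun z => a (ε⁻¹ • z)) volume x, hone]
  · refine (lintegral_mono fun x => ENNReal.ofReal_le_ofReal (hle x y)).trans_eq ?_
    rw [← ofReal_integral_eq_lintegral_ofReal (hB' y) (ae_of_all _ fun x =>
      mul_nonneg (by positivity) (mul_nonneg (ha0 _) (by positivity))), integral_const_mul,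
      integral_mul_const, integral_sub_right_eq_self (fun z => a (ε⁻¹ • z)) y, hone,
      ENNReal.ofReal_one]

/-- The Jacobian `ε ^ d` turns the kernel into the one at scale one with coefficient `w / ε²`; hence
one bound `M` serves all `ε`. -/
lemma dualDensity_jumpKernel_smul (a : (𝔼 d) → ℝ) (w : (𝔼 d) → (𝔼 d) → ℝ) {ε : ℝ} (hε : 0 < ε)
    (p : (𝔼 d) → ℝ≥0∞) (x : 𝔼 d) :
    dualDensity volume (jumpKernel a w ε) p (ε • x) =
      dualDensity volume (jumpKernel a (fun x y => (ε ^ 2)⁻¹ * w x y) 1) (fun x => p (ε • x)) x := by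
  have hpos : 0 < ε ^ d := pow_pos hε d
  simp only [dualDensity, ← pow_mul_jumpKernel_smul a w hε]
  congr 1
  · rw [lintegral_eq_mul_lintegral_comp_smul hε, ← lintegral_const_mul' _ _ ENNReal.ofReal_ne_top]
    exact lintegral_congr fun y => by rw [← mul_assoc, ENNReal.ofReal_mul hpos.le]
  · congr 3
    rw [integral_const_mul, Measure.integral_comp_smul_of_nonneg volume _ ε (hR := hε.le),
      finrank_euclideanSpace, Fintype.card_fin, smul_eq_mul, ← mul_assoc,
      mul_inv_cancel₀ hpos.ne', one_mul]

/-- The lattice `ℤ^d`. -/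
noncomputable def integerLattice (d : ℕ) : AddSubgroup (𝔼 d) :=
  (Submodule.span ℤ (range (EuclideanSpace.basisFun (Fin d) ℝ).toBasis)).toAddSubgroup

/-- The unit cell of `ℤ^d`. -/
noncomputable def unitCell (d : ℕ) : Set (𝔼 d) :=
  ZSpan.fundamentalDomain (EuclideanSpace.basisFun (Fin d) ℝ).toBasis

instance : Countable (integerLattice d) :=
  inferInstanceAs (Countable (Submodule.span ℤ
    (range (EuclideanSpace.basisFun (Fin d) ℝ).toBasis)))

lemma isAddFundamentalDomain_unitCell :
    IsAddFundamentalDomain (integerLattice d) (unitCell d) (volume : Measure (𝔼 d)) :=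
  ZSpan.isAddFundamentalDomain' _ _

lemma volume_unitCell_ne_top : volume (unitCell d) ≠ ∞ :=
  (ZSpan.fundamentalDomain_isBounded _).measure_lt_top.ne

lemma add_lattice_eq {w : (𝔼 d) → (𝔼 d) → ℝ}
    (hw : ∀ x y (i : Fin d), w (x + EuclideanSpace.single i 1) (y + EuclideanSpace.single i 1)
      = w x y) (g : integerLattice d) (x y : 𝔼 d) : w (g + x) (g + y) = w x y := by
  obtain ⟨g, hg⟩ := g
  simp only
  rw [integerLattice, Submodule.span_int_eq_addSubgroupClosure] at hg
  induction hg using AddSubgroup.closure_induction generalizing x y with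
  | mem g hg =>
    obtain ⟨i, rfl⟩ := hg
    simpa [add_comm] using hw x y i
  | zero => simp
  | add g g' _ _ h h' => simp only [add_assoc] at *; rw [h, h']
  | neg g _ h => simpa using (h (-g + x) (-g + y)).symm

/-- The bound `M` on periodic densities is stable under the dual of every averaged jump operator
at scale `ε`, as long as the averaging time is at most `ε ^ 2 / α₂`. -/
def IsStableDensityBound (a : (𝔼 d) → ℝ) (α₁ α₂ ε : ℝ) (M : ℝ≥0) : Prop :=
  ∀ (w : (𝔼 d) → (𝔼 d) → ℝ) (h : ℝ), 0 ≤ h → h * α₂ ≤ ε ^ 2 → Measurable (Function.uncurry w) →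
    (∀ x y (i : Fin d), w (x + EuclideanSpace.single i 1) (y + EuclideanSpace.single i 1)
      = w x y) → (∀ x y, h * α₁ ≤ w x y) → (∀ x y, w x y ≤ h * α₂) →
    ∀ p, IsPeriodicDensity volume (integerLattice d) (unitCell d) M (fun x => p (ε • x)) →
      IsPeriodicDensity volume (integerLattice d) (unitCell d) M
        (fun x => dualDensity volume (jumpKernel a w ε) p (ε • x))

/-- There is a stable bound on periodic densities which does not depend on the scale. -/
lemma exists_uniform_density_bound (ham : Measurable a) (ha0 : ∀ z, 0 ≤ a z) (hai : Integrable a)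
    (ha1 : ∫ z, a z = 1) {α₁ α₂ : ℝ} (h1 : 0 < α₁) (h2 : 0 < α₂) :
    ∃ M : ℝ≥0, 1 ≤ M ∧ ∀ ε, 0 < ε → IsStableDensityBound a α₁ α₂ ε M := by
  obtain ⟨M, hM1, hM⟩ := exists_isPeriodicDensity_dualDensity isAddFundamentalDomain_unitCell
    volume_unitCell_ne_top ham hai h1 h2
  refine ⟨M, hM1, fun ε hε w h hh hhε hw hper hge hle p hp => ?_⟩
  have hε2 : 0 < ε ^ 2 := by positivity
  simp only [dualDensity_jumpKernel_smul a w hε p]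
  have hw0 : ∀ x y, 0 ≤ w x y := fun x y => (by positivity : 0 ≤ h * α₁).trans (hge x y)
  have hk : IsSubMarkov volume (jumpKernel a (fun x y => (ε ^ 2)⁻¹ * w x y) 1) := by
    refine isSubMarkov_jumpKernel ham ha0 hai ha1 (hw.const_mul _)
      (fun x y => mul_nonneg (by positivity) (hw0 x y)) one_pos fun x y => ?_
    rw [inv_mul_le_iff₀ hε2, one_pow, mul_one]
    exact (hle x y).trans hhε
  have hk_eq : ∀ x y, jumpKernel a (fun x y => (ε ^ 2)⁻¹ * w x y) 1 x y
      = (ε ^ 2)⁻¹ * w x y * a (x - y) := fun x y => by simp [jumpKernel, mul_comm]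
  -- A step of length `h` at scale `ε` has length `h / ε²` at scale one.
  refine hM _ ((ε ^ 2)⁻¹ * h) (by positivity) hk (fun g x y => ?_) (fun x y => ?_) (fun x => ?_) _ hp
  · rw [hk_eq, hk_eq, add_lattice_eq hper, add_sub_add_left_eq_sub]
  · rw [hk_eq, mul_assoc _ h]
    exact mul_le_mul_of_nonneg_right (mul_le_mul_of_nonneg_left (hle x y) (by positivity)) (ha0 _)
  · have := integral_mono (μ := volume) (f := fun y => (ε ^ 2)⁻¹ * h * α₁ * a (x - y))
      ((hai.comp_sub_left x).const_mul _) (hk.integrable x) fun y => by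
        rw [hk_eq, mul_assoc _ h]
        exact mul_le_mul_of_nonneg_right
          (mul_le_mul_of_nonneg_left (hge x y) (by positivity)) (ha0 _)
    rwa [integral_const_mul, integral_sub_left_eq_self a volume x, ha1, mul_one] at this

end Scaling

/-! ### Quadratic forms of kernels integrated over a parameter. -/

section Kernel

variable {X : Type*} [MeasurableSpace X] {ν : Measure X}

lemma MeasureTheory.MemLp.lintegral_enorm_sq_ne_top {u : X → ℝ} (h2 : MemLp u 2 ν) :
    ∫⁻ x, ‖u x‖ₑ ^ 2 ∂ν ≠ ∞ := by
  rw [← eLpNorm_two_sq]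
  exact (ENNReal.pow_lt_top h2.2).ne

variable [SFinite ν] {k : X → X → ℝ}

lemma IsSubMarkov.integrable_mul_sq_snd (hk : IsSubMarkov ν k) {u : X → ℝ} (hu : Measurable u)
    (h2 : MemLp u 2 ν) : Integrable (fun q : X × X => k q.1 q.2 * u q.2 ^ 2) (ν.prod ν) := by
  have hm : Measurable fun q : X × X => k q.1 q.2 * u q.2 ^ 2 :=
    hk.measurable.mul ((hu.comp measurable_snd).pow_const 2)
  refine ⟨hm.aestronglyMeasurable, ?_⟩
  rw [hasFiniteIntegral_iff_enorm, lintegral_prod _ hm.enorm.aemeasurable]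
  simp only [enorm_mul, enorm_pow, Real.enorm_of_nonneg (hk.nonneg _ _)]
  exact (hk.lintegral_lintegral_sq_le hu).trans_lt h2.lintegral_enorm_sq_ne_top.lt_top

lemma IsSubMarkov.integrable_mul_sq_fst (hk : IsSubMarkov ν k) {u : X → ℝ} (hu : Measurable u)
    (h2 : MemLp u 2 ν) : Integrable (fun q : X × X => k q.1 q.2 * u q.1 ^ 2) (ν.prod ν) := by
  have hm : Measurable fun q : X × X => k q.1 q.2 * u q.1 ^ 2 :=
    hk.measurable.mul ((hu.comp measurable_fst).pow_const 2)
  refine ⟨hm.aestronglyMeasurable, ?_⟩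
  rw [hasFiniteIntegral_iff_enorm, lintegral_prod _ hm.enorm.aemeasurable]
  simp only [enorm_mul, enorm_pow, Real.enorm_of_nonneg (hk.nonneg _ _)]
  refine lt_of_le_of_lt (lintegral_mono fun x => ?_) h2.lintegral_enorm_sq_ne_top.lt_top
  rw [lintegral_mul_const _ (hk.measurable_row x).ennreal_ofReal]
  exact (mul_le_mul_left (hk.lintegral_row_le x) _).trans_eq (one_mul _)

/-- The quadratic form of a superposition of kernels dominated by a sub-Markov kernel. -/
lemma integral_mul_kernelOp_integral {S : Type*} [MeasurableSpace S] {ρ : Measure S}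
    [IsFiniteMeasure ρ] (hk : IsSubMarkov ν k) {κ : S → X → X → ℝ}
    (hκ : Measurable fun z : S × X × X => κ z.1 z.2.1 z.2.2) (hκ0 : ∀ s x y, 0 ≤ κ s x y) {C : ℝ}
    (hκC : ∀ s x y, κ s x y ≤ C * k x y) {u v : X → ℝ} (hu : Measurable u) (hv : Measurable v)
    (hu2 : MemLp u 2 ν) (hv2 : MemLp v 2 ν) :
    Integrable (fun s => ∫ x, v x * kernelOp ν (κ s) u x ∂ν) ρ ∧
      ∫ x, v x * kernelOp ν (fun x y => ∫ s, κ s x y ∂ρ) u x ∂ν =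
        ∫ s, ∫ x, v x * kernelOp ν (κ s) u x ∂ν ∂ρ := by
  set G : S × X × X → ℝ := fun z => v z.2.1 * (κ z.1 z.2.1 z.2.2 * (u z.2.2 - u z.2.1))
  -- Majorant from `|v x| |u y - u x| ≤ v x ^ 2 + u x ^ 2 + u y ^ 2`; the row and column bounds of
  -- `k` make it integrable, which justifies Fubini.
  set H : X × X → ℝ := fun q => C * (k q.1 q.2 * v q.1 ^ 2 + k q.1 q.2 * u q.1 ^ 2 +
    k q.1 q.2 * u q.2 ^ 2)
  have hH : Integrable H (ν.prod ν) := (((hk.integrable_mul_sq_fst hv hv2).add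
    (hk.integrable_mul_sq_fst hu hu2)).add (hk.integrable_mul_sq_snd hu hu2)).const_mul C
  have hG : Measurable G :=
    (hv.comp (measurable_fst.comp measurable_snd)).mul (hκ.mul
      ((hu.comp (measurable_snd.comp measurable_snd)).sub
        (hu.comp (measurable_fst.comp measurable_snd))))
  have hGH : ∀ z, ‖G z‖ ≤ H z.2 := by
    rintro ⟨s, x, y⟩
    have h0 := hκ0 s x y
    have h3 : |v x| * |u y - u x| ≤ v x ^ 2 + u x ^ 2 + u y ^ 2 := by
      have := abs_sub (u y) (u x)
      have h4 : |v x| * |u y - u x| ≤ |v x| * (|u y| + |u x|) :=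
        mul_le_mul_of_nonneg_left this (abs_nonneg _)
      nlinarith [sq_nonneg (|v x| - |u y|), sq_nonneg (|v x| - |u x|), sq_abs (v x), sq_abs (u x),
        sq_abs (u y)]
    calc ‖G (s, x, y)‖ = κ s x y * (|v x| * |u y - u x|) := by
          simp only [G, Real.norm_eq_abs, abs_mul, abs_of_nonneg h0]; ring
      _ ≤ C * k x y * (v x ^ 2 + u x ^ 2 + u y ^ 2) :=
          mul_le_mul (hκC s x y) h3 (by positivity) (h0.trans (hκC s x y))
      _ = H (x, y) := by simp only [H]; ring
  have hGi : Integrable G (ρ.prod (ν.prod ν)) :=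
    (hH.comp_snd ρ).mono' hG.aestronglyMeasurable (ae_of_all _ hGH)
  have hslice : ∀ s, ∫ q, G (s, q) ∂(ν.prod ν) = ∫ x, v x * kernelOp ν (κ s) u x ∂ν := fun s => by
    have hs : Integrable (fun q => G (s, q)) (ν.prod ν) :=
      hH.mono' (hG.comp measurable_prodMk_left).aestronglyMeasurable
        (ae_of_all _ fun q => hGH (s, q))
    rw [integral_prod _ hs]
    simp only [G, kernelOp, integral_const_mul]
  refine ⟨by simpa only [hslice] using hGi.integral_prod_left, ?_⟩
  simp only [← hslice]
  rw [integral_integral_swap (f := fun s q => G (s, q)) hGi, integral_prod _ hGi.integral_prod_right]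
  simp only [G, kernelOp, integral_const_mul, integral_mul_const]

end Kernel

/-! ### Local error of the Euler scheme. -/

section Step

variable {H : Type*} [NormedAddCommGroup H] [InnerProductSpace ℝ H] [CompleteSpace H]

/-- The local error of one explicit Euler step with averaged generator. -/
lemma norm_sub_euler_step_le {t₁ t₂ : ℝ} (h12 : t₁ ≤ t₂) {D f Ξ : ℝ → H} {S : ℝ → H →L[ℝ] H}
    {C : ℝ} (hC : 0 ≤ C) (hS : ∀ s x, ‖S s x‖ ≤ C * ‖x‖) (hD : IntegrableOn D (Ioc t₁ t₂))
    (hf : IntegrableOn f (Ioc t₁ t₂)) (hΞ : ∀ s ∈ Icc t₁ t₂, Ξ s = Ξ t₁ + ∫ r in t₁..s, D r)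
    (heq : ∀ᵐ s ∂(volume.restrict (Ioc t₁ t₂)), D s = S s (Ξ s) + f s) {Tu : H}
    (hT : ∀ v : H, IntegrableOn (fun s => inner ℝ v (S s (Ξ t₁))) (Ioc t₁ t₂) ∧
      inner ℝ v Tu = ∫ s in Ioc t₁ t₂, inner ℝ v (S s (Ξ t₁))) :
    ‖Ξ t₂ - (Ξ t₁ + Tu)‖ ≤ (∫ s in t₁..t₂, ‖f s‖) + (t₂ - t₁) * C * ∫ s in t₁..t₂, ‖D s‖ := by
  set e := Ξ t₂ - (Ξ t₁ + Tu) with he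
  set R := ∫ s in t₁..t₂, ‖D s‖ with hR
  have hdist : ∀ s ∈ Ioc t₁ t₂, ‖Ξ s - Ξ t₁‖ ≤ R := fun s hs => by
    rw [hΞ s ⟨hs.1.le, hs.2⟩, add_sub_cancel_left, hR, intervalIntegral.integral_of_le h12,
      intervalIntegral.integral_of_le hs.1.le]
    refine (norm_integral_le_integral_norm _).trans (setIntegral_mono_set hD.norm
      (ae_of_all _ fun _ => norm_nonneg _) (Ioc_subset_Ioc_right hs.2).eventuallyLE)
  -- `Tu` is known only as a weak integral, so the error is tested against itself and one factor
  -- `‖e‖` is divided out at the end. The integrand is the pairing of `e` with `f s + S s (Ξ s - Ξ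
  -- t₁)`.
  have hee : inner ℝ e e = ∫ s in Ioc t₁ t₂, (inner ℝ e (D s) - inner ℝ e (S s (Ξ t₁))) := by
    rw [integral_sub (hD.const_inner e) (hT e).1, integral_inner hD e, ← (hT e).2, ← inner_sub_right,
      ← intervalIntegral.integral_of_le h12]
    congr 1
    rw [he, hΞ t₂ ⟨h12, le_rfl⟩]
    abel
  have hbound : ‖∫ s in Ioc t₁ t₂, (inner ℝ e (D s) - inner ℝ e (S s (Ξ t₁)))‖ ≤
      ∫ s in Ioc t₁ t₂, ‖e‖ * (‖f s‖ + C * R) := by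
    refine norm_integral_le_of_norm_le ((hf.norm.add (integrable_const _)).const_mul _) ?_
    filter_upwards [heq, ae_restrict_mem measurableSet_Ioc] with s hs hmem
    rw [← inner_sub_right, hs, add_sub_right_comm, ← map_sub, add_comm]
    refine (norm_inner_le_norm _ _).trans (mul_le_mul_of_nonneg_left ?_ (norm_nonneg _))
    refine (norm_add_le _ _).trans (add_le_add le_rfl ((hS _ _).trans ?_))
    exact mul_le_mul_of_nonneg_left (hdist s hmem) hC
  have hval : ∫ s in Ioc t₁ t₂, ‖e‖ * (‖f s‖ + C * R) =
      ‖e‖ * ((∫ s in t₁..t₂, ‖f s‖) + (t₂ - t₁) * C * R) := by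
    rw [integral_const_mul, integral_add hf.norm (integrable_const _), setIntegral_const,
      intervalIntegral.integral_of_le h12, Real.volume_real_Ioc_of_le h12, smul_eq_mul]
    ring
  rw [← hee, hval, real_inner_self_eq_norm_mul_norm, norm_mul, norm_norm] at hbound
  rcases (norm_nonneg e).eq_or_lt with h0 | hpos
  · rw [← h0]
    have hR0 : 0 ≤ R := intervalIntegral.integral_nonneg_of_forall h12 fun _ => norm_nonneg _
    exact add_nonneg (intervalIntegral.integral_nonneg_of_forall h12 fun _ => norm_nonneg _)
      (mul_nonneg (mul_nonneg (sub_nonneg.2 h12) hC) hR0)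
  · exact le_of_mul_le_mul_left hbound hpos

end Step

/-! ### The time-dependent generator and the energy estimate. -/

section Evolution

lemma kernelOp_const_mul {X : Type*} [MeasurableSpace X] (ν : Measure X) (c : ℝ) (k : X → X → ℝ)
    (u : X → ℝ) (x : X) : kernelOp ν (fun x y => c * k x y) u x = c * kernelOp ν k u x := by
  simp only [kernelOp, mul_assoc, integral_const_mul]

lemma IsSubMarkov.inner_toCLM {X : Type*} [MeasurableSpace X] {ν : Measure X} [SFinite ν]
    {k : X → X → ℝ} (hk : IsSubMarkov ν k) (v u : Lp ℝ 2 ν) :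
    inner ℝ v (hk.toCLM u) = ∫ x, v x * kernelOp ν k u x ∂ν := by
  rw [L2.inner_def]
  refine integral_congr_ae ?_
  filter_upwards [hk.coeFn_toCLM u] with x hx
  rw [hx]
  simp [mul_comm]

local notation "𝔼" d => EuclideanSpace ℝ (Fin d)

variable {d : ℕ}

/-- A nonnegative Borel probability density. -/
structure IsBorelDensity (a : (𝔼 d) → ℝ) : Prop where
  measurable : Measurable a
  nonneg : ∀ z, 0 ≤ a z
  integrable : Integrable a
  integral_eq_one : ∫ z, a z = 1

/-- The conditions on one realization of the medium which are used for the energy estimate. -/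
structure IsPeriodicMedium (m : (𝔼 d) → (𝔼 d) → ℝ → ℝ) (α₁ α₂ : ℝ) : Prop where
  measurable : Measurable fun q : (𝔼 d) × (𝔼 d) × ℝ => m q.1 q.2.1 q.2.2
  periodic : ∀ x y t (i : Fin d),
    m (x + EuclideanSpace.single i 1) (y + EuclideanSpace.single i 1) t = m x y t
  pos : 0 < α₁
  lower : ∀ x y t, α₁ ≤ m x y t
  upper : ∀ x y t, m x y t ≤ α₂

namespace IsPeriodicMedium

variable {a : (𝔼 d) → ℝ} {m : (𝔼 d) → (𝔼 d) → ℝ → ℝ} {α₁ α₂ : ℝ}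

lemma pos_upper (hm : IsPeriodicMedium m α₁ α₂) : 0 < α₂ :=
  hm.pos.trans_le ((hm.lower 0 0 0).trans (hm.upper 0 0 0))

lemma nonneg (hm : IsPeriodicMedium m α₁ α₂) (x y t) : 0 ≤ m x y t :=
  hm.pos.le.trans (hm.lower x y t)

/-- The factor `ε² / α₂` normalizes the rates to a sub-Markov kernel; `generator` undoes it. -/
lemma isSubMarkov_slice (hm : IsPeriodicMedium m α₁ α₂) (ha : IsBorelDensity a) {ε : ℝ}
    (hε : 0 < ε) (s : ℝ) :
    IsSubMarkov volume (jumpKernel a (fun x y => ε ^ 2 / α₂ * m x y (s / ε ^ 2)) ε) := by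
  have h2 := hm.pos_upper
  refine isSubMarkov_jumpKernel ha.measurable ha.nonneg ha.integrable ha.integral_eq_one ?_
    (fun x y => mul_nonneg (by positivity) (hm.nonneg _ _ _)) hε fun x y => ?_
  · refine Measurable.const_mul ?_ _
    exact hm.measurable.comp (f := fun q : (𝔼 d) × (𝔼 d) => (q.1, q.2, s / ε ^ 2)) (by fun_prop)
  · rw [div_mul_eq_mul_div, div_le_iff₀ h2]
    exact mul_le_mul_of_nonneg_left (hm.upper _ _ _) (by positivity)

/-- The jump operator at time `s` on `L²`. -/
noncomputable def generator (hm : IsPeriodicMedium m α₁ α₂) (ha : IsBorelDensity a) {ε : ℝ}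
    (hε : 0 < ε) (s : ℝ) : Lp ℝ 2 (volume : Measure (𝔼 d)) →L[ℝ] Lp ℝ 2 (volume : Measure (𝔼 d)) :=
  (α₂ / ε ^ 2) • (hm.isSubMarkov_slice ha hε s).toCLM

lemma kernelOp_slice (hm : IsPeriodicMedium m α₁ α₂) {ε : ℝ} (hε : 0 < ε) (s : ℝ)
    (u : (𝔼 d) → ℝ) (x : 𝔼 d) :
    α₂ / ε ^ 2 * kernelOp volume
      (jumpKernel a (fun x y => ε ^ 2 / α₂ * m x y (s / ε ^ 2)) ε) u x =
      kernelOp volume (jumpKernel a (fun x y => m x y (s / ε ^ 2)) ε) u x := by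
  have h2 := hm.pos_upper.ne'
  rw [← kernelOp_const_mul]
  congr 1
  ext x y
  simp only [jumpKernel]
  field_simp

lemma coeFn_generator (hm : IsPeriodicMedium m α₁ α₂) (ha : IsBorelDensity a) {ε : ℝ}
    (hε : 0 < ε) (s : ℝ) (u : Lp ℝ 2 (volume : Measure (𝔼 d))) :
    hm.generator ha hε s u =ᵐ[volume] jumpOperator a m ε s u := by
  filter_upwards [Lp.coeFn_smul (α₂ / ε ^ 2) ((hm.isSubMarkov_slice ha hε s).toCLM u),
    (hm.isSubMarkov_slice ha hε s).coeFn_toCLM u] with x h1 h2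
  rw [jumpOperator_eq_kernelOp, ← hm.kernelOp_slice hε, ← h2]
  exact h1

lemma norm_generator_apply_le (hm : IsPeriodicMedium m α₁ α₂) (ha : IsBorelDensity a) {ε : ℝ}
    (hε : 0 < ε) (s : ℝ) (u : Lp ℝ 2 (volume : Measure (𝔼 d))) :
    ‖hm.generator ha hε s u‖ ≤ α₂ / ε ^ 2 * 3 * ‖u‖ := by
  have h2 := hm.pos_upper
  rw [generator, _root_.smul_apply, norm_smul, Real.norm_of_nonneg (by positivity),
    mul_assoc]
  exact mul_le_mul_of_nonneg_left (IsSubMarkov.norm_toCLM_apply_le _ u) (by positivity)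

lemma inner_generator (hm : IsPeriodicMedium m α₁ α₂) (ha : IsBorelDensity a) {ε : ℝ}
    (hε : 0 < ε) (s : ℝ) (v u : Lp ℝ 2 (volume : Measure (𝔼 d))) :
    inner ℝ v (hm.generator ha hε s u) =
      ∫ x, v x * kernelOp volume (jumpKernel a (fun x y => m x y (s / ε ^ 2)) ε) u x := by
  rw [generator, _root_.smul_apply, inner_smul_right, IsSubMarkov.inner_toCLM,
    ← integral_const_mul]
  refine integral_congr_ae (ae_of_all _ fun x => ?_)
  simp only [← hm.kernelOp_slice hε]
  ring

/-- The coefficient integrated over the time interval `(t₁, t₂]`, in the time scale `ε²`. -/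
noncomputable def timeIntegral (m : (𝔼 d) → (𝔼 d) → ℝ → ℝ) (ε t₁ t₂ : ℝ) (x y : 𝔼 d) : ℝ :=
  ∫ s in Ioc t₁ t₂, m x y (s / ε ^ 2)

section TimeIntegral

variable {ε t₁ t₂ : ℝ}

lemma integrableOn_time (hm : IsPeriodicMedium m α₁ α₂) (x y : 𝔼 d) :
    IntegrableOn (fun s => m x y (s / ε ^ 2)) (Ioc t₁ t₂) := by
  refine Integrable.mono' (integrable_const α₂) ?_ (ae_of_all _ fun s => ?_)
  · exact (hm.measurable.comp (f := fun s : ℝ => (x, y, s / ε ^ 2))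
      (by fun_prop)).aestronglyMeasurable
  · rw [Real.norm_of_nonneg (hm.nonneg _ _ _)]
    exact hm.upper _ _ _

lemma le_timeIntegral (hm : IsPeriodicMedium m α₁ α₂) (h12 : t₁ ≤ t₂) (x y : 𝔼 d) :
    (t₂ - t₁) * α₁ ≤ timeIntegral m ε t₁ t₂ x y := by
  have := integral_mono (integrable_const α₁) (hm.integrableOn_time (ε := ε) (t₁ := t₁) (t₂ := t₂)
    x y) fun s => hm.lower _ _ _
  rwa [setIntegral_const, Real.volume_real_Ioc_of_le h12, smul_eq_mul] at this

lemma timeIntegral_le (hm : IsPeriodicMedium m α₁ α₂) (h12 : t₁ ≤ t₂) (x y : 𝔼 d) :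
    timeIntegral m ε t₁ t₂ x y ≤ (t₂ - t₁) * α₂ := by
  have := integral_mono (hm.integrableOn_time (ε := ε) (t₁ := t₁) (t₂ := t₂) x y)
    (integrable_const α₂) fun s => hm.upper _ _ _
  rwa [setIntegral_const, Real.volume_real_Ioc_of_le h12, smul_eq_mul] at this

lemma measurable_timeIntegral (hm : IsPeriodicMedium m α₁ α₂) :
    Measurable (Function.uncurry (timeIntegral m ε t₁ t₂)) :=
  (StronglyMeasurable.integral_prod_right'
    (f := fun q : ((𝔼 d) × (𝔼 d)) × ℝ => m q.1.1 q.1.2 (q.2 / ε ^ 2))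
    (hm.measurable.comp (f := fun q : ((𝔼 d) × (𝔼 d)) × ℝ => (q.1.1, q.1.2, q.2 / ε ^ 2))
      (by fun_prop)).stronglyMeasurable).measurable

lemma isSubMarkov_timeIntegral (hm : IsPeriodicMedium m α₁ α₂) (ha : IsBorelDensity a)
    (hε : 0 < ε) (h12 : t₁ ≤ t₂) (hstep : (t₂ - t₁) * α₂ ≤ ε ^ 2) :
    IsSubMarkov volume (jumpKernel a (timeIntegral m ε t₁ t₂) ε) :=
  isSubMarkov_jumpKernel ha.measurable ha.nonneg ha.integrable ha.integral_eq_one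
    hm.measurable_timeIntegral
    (fun x y => (mul_nonneg (sub_nonneg.2 h12) hm.pos.le).trans (hm.le_timeIntegral h12 x y)) hε
    fun x y => (hm.timeIntegral_le h12 x y).trans hstep

/-- Supplies the weak-integral hypothesis of `norm_sub_euler_step_le`. The constant coefficient `ε²`
gives the dominating sub-Markov kernel. -/
lemma inner_toCLM_timeIntegral (hm : IsPeriodicMedium m α₁ α₂) (ha : IsBorelDensity a)
    (hε : 0 < ε) (hK : IsSubMarkov volume (jumpKernel a (timeIntegral m ε t₁ t₂) ε))
    (v u : Lp ℝ 2 (volume : Measure (𝔼 d))) :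
    IntegrableOn (fun s => inner ℝ v (hm.generator ha hε s u)) (Ioc t₁ t₂) ∧
      inner ℝ v (hK.toCLM u) = ∫ s in Ioc t₁ t₂, inner ℝ v (hm.generator ha hε s u) := by
  have hk : IsSubMarkov volume (jumpKernel a (fun _ _ => ε ^ 2) ε) :=
    isSubMarkov_jumpKernel ha.measurable ha.nonneg ha.integrable ha.integral_eq_one
      measurable_const (fun _ _ => by positivity) hε fun _ _ => le_rfl
  have h := integral_mul_kernelOp_integral (ρ := volume.restrict (Ioc t₁ t₂)) hk
    (κ := fun s => jumpKernel a (fun x y => m x y (s / ε ^ 2)) ε) (C := α₂ / ε ^ 2) ?_ ?_ ?_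
    (Lp.stronglyMeasurable u).measurable (Lp.stronglyMeasurable v).measurable (Lp.memLp u)
    (Lp.memLp v)
  · simp only [hm.inner_generator, hK.inner_toCLM]
    refine ⟨h.1, ?_⟩
    rw [← h.2]
    simp only [jumpKernel, integral_const_mul]
    rfl
  · refine Measurable.const_mul (Measurable.mul ?_ ?_) _
    · exact ha.measurable.comp (f := fun q : ℝ × (𝔼 d) × (𝔼 d) => ε⁻¹ • (q.2.1 - q.2.2))
        (by fun_prop)
    · exact hm.measurable.comp
        (f := fun q : ℝ × (𝔼 d) × (𝔼 d) => (ε⁻¹ • q.2.1, ε⁻¹ • q.2.2, q.1 / ε ^ 2)) (by fun_prop)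
  · exact fun s x y =>
      mul_nonneg (by positivity) (mul_nonneg (ha.nonneg _) (hm.nonneg _ _ _))
  · intro s x y
    have h3 : α₂ / ε ^ 2 * jumpKernel a (fun _ _ => ε ^ 2) ε x y =
        1 / ε ^ (d + 2) * (a (ε⁻¹ • (x - y)) * α₂) := by
      simp only [jumpKernel]
      field_simp
    rw [h3]
    exact mul_le_mul_of_nonneg_left (mul_le_mul_of_nonneg_left (hm.upper _ _ _) (ha.nonneg _))
      (by positivity)

end TimeIntegral

/-- The energy estimate for a solution, up to the error of the Euler scheme with `n` steps. -/
lemma norm_le_of_euler (hm : IsPeriodicMedium m α₁ α₂) (ha : IsBorelDensity a) {M : ℝ≥0}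
    (hM1 : 1 ≤ M) {ε : ℝ} (hε : 0 < ε)
    (hM : IsStableDensityBound a α₁ α₂ ε M)
    {t : ℝ} (ht : 0 ≤ t) {D f Ξ : ℝ → Lp ℝ 2 (volume : Measure (𝔼 d))}
    (hD : IntegrableOn D (Ioc 0 t)) (hf : IntegrableOn f (Ioc 0 t))
    (hΞ : ∀ s ∈ Icc 0 t, Ξ s = Ξ 0 + ∫ r in (0 : ℝ)..s, D r)
    (heq : ∀ᵐ s ∂(volume.restrict (Ioc 0 t)), D s = hm.generator ha hε s (Ξ s) + f s)
    {n : ℕ} (hn : n ≠ 0) (hstep : t / n * α₂ ≤ ε ^ 2) :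
    ‖Ξ t‖ ≤ √M * (‖Ξ 0‖ + ((∫ s in (0 : ℝ)..t, ‖f s‖) +
      t / n * (α₂ / ε ^ 2 * 3) * ∫ s in (0 : ℝ)..t, ‖D s‖)) := by
  have h2 := hm.pos_upper
  set h := t / n with hh
  have hn0 : (0 : ℝ) < n := by positivity
  have hh0 : 0 ≤ h := by positivity
  set τ : ℕ → ℝ := fun i => i * h with hτ
  have hτ_succ : ∀ i, τ (i + 1) - τ i = h := fun i => by simp only [hτ]; push_cast; ring
  have hτ_le : ∀ i, τ i ≤ τ (i + 1) := fun i => by linarith [hτ_succ i]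
  have hτ_n : τ n = t := by simp only [hτ, hh]; field_simp
  have hτ0 : τ 0 = 0 := by simp [hτ]
  have hτ_mono : Monotone τ := monotone_nat_of_le_succ hτ_le
  have hτ_nonneg : ∀ i, 0 ≤ τ i := fun i => hτ0 ▸ hτ_mono (Nat.zero_le i)
  have hτ_bd : ∀ i < n, τ (i + 1) ≤ t := fun i hi => hτ_n ▸ hτ_mono hi
  have hk : ∀ i, IsSubMarkov volume (jumpKernel a (timeIntegral m ε (τ i) (τ (i + 1))) ε) :=
    fun i => hm.isSubMarkov_timeIntegral ha hε (hτ_le i) (by rwa [hτ_succ])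
  have hpm : ∀ p : (𝔼 d) → ℝ≥0∞, IsPeriodicDensity volume (integerLattice d) (unitCell d) M
      (fun x => p (ε • x)) → Measurable p := fun p hp => by
    have := hp.measurable.comp (measurable_const_smul (ε⁻¹ : ℝ))
    simpa [Function.comp_def, smul_smul, mul_inv_cancel₀ hε.ne'] using this
  have hpM : ∀ p : (𝔼 d) → ℝ≥0∞, IsPeriodicDensity volume (integerLattice d) (unitCell d) M
      (fun x => p (ε • x)) → ∀ x, p x ≤ M := fun p hp x => by
    simpa [smul_smul, mul_inv_cancel₀ hε.ne'] using hp.le_bound (ε⁻¹ • x)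
  -- The final weight `p = 1` makes the left side the plain `L²` norm at time `t`.
  have hmain := eLpNorm_withDensity_le_of_steps (M := M) (Good := fun p =>
    IsPeriodicDensity volume (integerLattice d) (unitCell d) M (fun x => p (ε • x)))
    hpm hpM hk (fun i p hp => hM _ h hh0 hstep hm.measurable_timeIntegral
      (fun x y j => by simp only [timeIntegral, hm.periodic])
      (fun x y => hτ_succ i ▸ hm.le_timeIntegral (hτ_le i) x y)
      (fun x y => hτ_succ i ▸ hm.timeIntegral_le (hτ_le i) x y) p hp)
    (fun i => Ξ (τ i)) n (p := 1)
    ⟨measurable_const, fun _ _ => rfl, by simp, fun _ => by simpa using hM1⟩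
  have hI : ∀ i < n, Ioc (τ i) (τ (i + 1)) ⊆ Ioc 0 t := fun i hi =>
    Ioc_subset_Ioc (hτ_nonneg i) (hτ_bd i hi)
  have hsub : ∀ i < n, ∀ {F : ℝ → Lp ℝ 2 (volume : Measure (𝔼 d))}, IntegrableOn F (Ioc 0 t) →
      IntervalIntegrable F volume (τ i) (τ (i + 1)) := fun i hi F hF =>
    (intervalIntegrable_iff_integrableOn_Ioc_of_le (hτ_le i)).2 (hF.mono_set (hI i hi))
  have herr : ∀ i < n, ‖Ξ (τ (i + 1)) - (Ξ (τ i) + (hk i).toCLM (Ξ (τ i)))‖ ≤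
      (∫ s in τ i..τ (i + 1), ‖f s‖) +
        h * (α₂ / ε ^ 2 * 3) * ∫ s in τ i..τ (i + 1), ‖D s‖ := fun i hi => by
    have := norm_sub_euler_step_le (hτ_le i) (by positivity) (hm.norm_generator_apply_le ha hε)
      (hD.mono_set (hI i hi)) (hf.mono_set (hI i hi)) (Ξ := Ξ) (fun s hs => ?_)
      (ae_restrict_of_ae_restrict_of_subset (hI i hi) heq)
      (fun v => hm.inner_toCLM_timeIntegral ha hε (hk i) v (Ξ (τ i)))
    · rwa [hτ_succ] at this
    · have hs0 : 0 ≤ s := (hτ_nonneg i).trans hs.1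
      have hst : s ≤ t := hs.2.trans (hτ_bd i hi)
      have hi0 : IntervalIntegrable D volume 0 (τ i) :=
        (intervalIntegrable_iff_integrableOn_Ioc_of_le (hτ_nonneg i)).2
          (hD.mono_set (Ioc_subset_Ioc_right (hs.1.trans hst)))
      have his : IntervalIntegrable D volume (τ i) s :=
        (intervalIntegrable_iff_integrableOn_Ioc_of_le hs.1).2
          (hD.mono_set (Ioc_subset_Ioc (hτ_nonneg i) hst))
      rw [hΞ s ⟨hs0, hst⟩, hΞ (τ i) ⟨hτ_nonneg i, hs.1.trans hst⟩, add_assoc,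
        intervalIntegral.integral_add_adjacent_intervals hi0 his]
  -- Each local error has `∫ ‖D‖` only over its own step, so the sum keeps the single factor `h`.
  have hsum : ∑ i ∈ Finset.range n, ‖Ξ (τ (i + 1)) - (Ξ (τ i) + (hk i).toCLM (Ξ (τ i)))‖ ≤
      (∫ s in (0 : ℝ)..t, ‖f s‖) + h * (α₂ / ε ^ 2 * 3) * ∫ s in (0 : ℝ)..t, ‖D s‖ := by
    refine (Finset.sum_le_sum fun i hi => herr i (Finset.mem_range.1 hi)).trans_eq ?_
    rw [Finset.sum_add_distrib, ← Finset.mul_sum,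
      intervalIntegral.sum_integral_adjacent_intervals fun i hi => (hsub i hi hf).norm,
      intervalIntegral.sum_integral_adjacent_intervals fun i hi => (hsub i hi hD).norm, hτ_n, hτ0]
  have hreal : ‖Ξ t‖ ≤ √M * (‖Ξ 0‖ + ∑ i ∈ Finset.range n,
      ‖Ξ (τ (i + 1)) - (Ξ (τ i) + (hk i).toCLM (Ξ (τ i)))‖) := by
    rw [withDensity_one, ← Lp.enorm_def, hτ_n, hτ0] at hmain
    have h3 : ∀ u : Lp ℝ 2 (volume : Measure (𝔼 d)), ‖u‖ₑ = ENNReal.ofReal ‖u‖ := fun u =>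
      (ofReal_norm u).symm
    have h4 : ((NNReal.sqrt M : ℝ≥0) : ℝ≥0∞) = ENNReal.ofReal √M := by
      rw [← Real.coe_sqrt, ENNReal.ofReal_coe_nnreal]
    simp only [h3] at hmain
    rwa [h4, ← ENNReal.ofReal_sum_of_nonneg fun _ _ => norm_nonneg _,
      ← ENNReal.ofReal_add (norm_nonneg _) (Finset.sum_nonneg fun _ _ => norm_nonneg _),
      ← ENNReal.ofReal_mul (Real.sqrt_nonneg _), ENNReal.ofReal_le_ofReal_iff (by positivity)]
      at hmain
  exact hreal.trans (by gcongr)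

/-- The energy estimate for a solution: the Euler scheme bounds it as the step tends to zero. -/
lemma norm_le_of_isCauchySolution (hm : IsPeriodicMedium m α₁ α₂) (ha : IsBorelDensity a) {M : ℝ≥0}
    (hM1 : 1 ≤ M) {ε : ℝ} (hε : 0 < ε)
    (hM : IsStableDensityBound a α₁ α₂ ε M)
    {T : ℝ} (hT : 0 < T) {f Ξ : ℝ → Lp ℝ 2 (volume : Measure (𝔼 d))}
    {g₀ : Lp ℝ 2 (volume : Measure (𝔼 d))} (hf : IntegrableOn f (Ioo 0 T))
    (hΞ : IsCauchySolution a m ε T f g₀ Ξ) {t : ℝ} (ht : t ∈ Ioo 0 T) :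
    ‖Ξ t‖ ≤ √M * (‖g₀‖ + ∫ s in (0 : ℝ)..t, ‖f s‖) := by
  obtain ⟨D, hD, hΞD, heq⟩ := hΞ
  have hsub : Ioc 0 t ⊆ Ioo 0 T := fun s hs => ⟨hs.1, hs.2.trans_lt ht.2⟩
  have h0 : Ξ 0 = g₀ := by simpa using hΞD 0 ⟨le_rfl, hT.le⟩
  have heq' : ∀ᵐ s ∂(volume.restrict (Ioc 0 t)), D s = hm.generator ha hε s (Ξ s) + f s := by
    refine ae_restrict_of_ae_restrict_of_subset hsub ?_
    filter_upwards [heq] with s hs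
    refine Lp.ext ?_
    filter_upwards [hs, Lp.coeFn_add (hm.generator ha hε s (Ξ s)) (f s),
      hm.coeFn_generator ha hε s (Ξ s)] with x h1 h2 h3
    rw [h2, Pi.add_apply, h3, ← h1]
    ring
  -- The factor `α₂ / ε²` is harmless: `ε` stays fixed while `n → ∞`, and it disappears from the
  -- limit.
  have hlim : Filter.Tendsto (fun n : ℕ => √M * (‖g₀‖ + ((∫ s in (0 : ℝ)..t, ‖f s‖) +
      t / n * (α₂ / ε ^ 2 * 3) * ∫ s in (0 : ℝ)..t, ‖D s‖))) Filter.atTop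
      (nhds (√M * (‖g₀‖ + ((∫ s in (0 : ℝ)..t, ‖f s‖) +
        0 * (α₂ / ε ^ 2 * 3) * ∫ s in (0 : ℝ)..t, ‖D s‖)))) :=
    ((((tendsto_const_div_atTop_nhds_zero_nat t).mul_const _).mul_const _).const_add _
      |>.const_add _).const_mul _
  rw [zero_mul, zero_mul, add_zero] at hlim
  refine ge_of_tendsto hlim ?_
  have hsmall : ∀ᶠ n : ℕ in Filter.atTop, t / n * α₂ < ε ^ 2 := by
    have := (tendsto_const_div_atTop_nhds_zero_nat t).mul_const α₂
    rw [zero_mul] at this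
    exact this.eventually_lt_const (by positivity)
  filter_upwards [hsmall, Filter.eventually_ne_atTop 0] with n hn hn0
  rw [← h0]
  exact hm.norm_le_of_euler ha hM1 hε hM ht.1.le (hD.mono_set hsub) (hf.mono_set hsub)
    (fun s hs => h0 ▸ hΞD s ⟨hs.1, hs.2.trans ht.2.le⟩) heq' hn0 hn.le

end IsPeriodicMedium

end Evolution

/-! ### Borel representative of the kernel and the final estimate. -/

lemma IsJumpKernel.exists_isBorelDensity {d : ℕ} {a : EuclideanSpace ℝ (Fin d) → ℝ}
    (ha : IsJumpKernel a) : ∃ a', IsBorelDensity a' ∧ a =ᵐ[volume] a' := by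
  obtain ⟨b, hb, hab⟩ := ha.integrable.aestronglyMeasurable
  have h : a =ᵐ[volume] fun z => max (b z) 0 := by
    filter_upwards [hab] with z hz
    rw [← hz, max_eq_left (ha.nonneg z)]
  exact ⟨_, ⟨hb.measurable.max measurable_const, fun z => le_max_right _ _,
    ha.integrable.congr h, (integral_congr_ae h).symm.trans ha.integral_eq_one⟩, h⟩

theorem proposition4p1 {d : ℕ} (a : EuclideanSpace ℝ (Fin d) → ℝ) (ha : IsJumpKernel a)
    {Ω : Type*} [MeasurableSpace Ω] (P : Measure Ω) (τ : ℝ → Ω → Ω)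
    (μ : Ω → EuclideanSpace ℝ (Fin d) → EuclideanSpace ℝ (Fin d) → ℝ → ℝ) (α₁ α₂ : ℝ)
    (hμ : IsStationaryErgodicMedium P τ μ α₁ α₂) :
    ∃ (C₁ : ℝ → ℝ≥0) (C₂ : ℝ≥0), ∀ (ω : Ω) (ε : ℝ), 0 < ε → ∀ T : ℝ, 0 < T →
      ∀ (f : ℝ → Lp ℝ 2 (volume : Measure (EuclideanSpace ℝ (Fin d))))
        (g₀ : Lp ℝ 2 (volume : Measure (EuclideanSpace ℝ (Fin d))))
        (Ξ : ℝ → Lp ℝ 2 (volume : Measure (EuclideanSpace ℝ (Fin d)))),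
        MemLp f 2 (volume.restrict (Ioo 0 T)) →
        IsCauchySolution a (μ ω) ε T f g₀ Ξ →
        eLpNorm Ξ ∞ (volume.restrict (Ioo 0 T)) ≤
          C₁ T * eLpNorm f 2 (volume.restrict (Ioo 0 T)) + C₂ * ‖g₀‖ₑ := by
  have hm : ∀ ω, IsPeriodicMedium (μ ω) α₁ α₂ := fun ω =>
    ⟨hμ.measurable_realization ω, fun x y t i => by rw [hμ.periodic_left, hμ.periodic_right],
      hμ.pos, hμ.lower ω, hμ.upper ω⟩
  -- A sample point is needed to deduce `0 < α₂` from the bounds on the coefficient.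
  rcases isEmpty_or_nonempty Ω with hΩ | ⟨⟨ω₀⟩⟩
  · exact ⟨0, 0, fun ω => hΩ.elim ω⟩
  obtain ⟨b, hb, hab⟩ := ha.exists_isBorelDensity
  obtain ⟨M, hM1, hM⟩ := exists_uniform_density_bound hb.measurable hb.nonneg hb.integrable
    hb.integral_eq_one hμ.pos (hm ω₀).pos_upper
  -- `√M` converts the bound on the weight into one on norms; `√T` is Cauchy–Schwarz in time for
  -- `f`.
  refine ⟨fun T => NNReal.sqrt M * NNReal.sqrt T.toNNReal, NNReal.sqrt M,
    fun ω ε hε T hT f g₀ Ξ hf hΞ => ?_⟩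
  have hΞb : IsCauchySolution b (μ ω) ε T f g₀ Ξ := by
    obtain ⟨D, hD, hΞD, heq⟩ := hΞ
    refine ⟨D, hD, hΞD, ?_⟩
    simpa only [jumpOperator_congr_ae hab (μ ω) hε] using heq
  have hf1 : IntegrableOn f (Ioo 0 T) := hf.integrable (by norm_num)
  have hL1 : ∫⁻ s in Ioo 0 T, ‖f s‖ₑ ≤
      NNReal.sqrt T.toNNReal * eLpNorm f 2 (volume.restrict (Ioo 0 T)) := by
    have h := eLpNorm_le_eLpNorm_mul_rpow_measure_univ (p := 1) (q := 2) (by norm_num)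
      hf.aestronglyMeasurable
    rw [eLpNorm_one_eq_lintegral_enorm, Measure.restrict_apply_univ, Real.volume_Ioo, sub_zero,
      mul_comm] at h
    refine h.trans_eq ?_
    congr 1
    rw [NNReal.sqrt_eq_rpow, ENNReal.coe_rpow_of_nonneg _ (by norm_num)]
    norm_num [ENNReal.ofReal]
  rw [eLpNorm_exponent_top]
  refine essSup_le_of_ae_le _ ?_
  filter_upwards [ae_restrict_mem measurableSet_Ioo] with t ht
  have hle := (hm ω).norm_le_of_isCauchySolution hb hM1 hε (hM ε hε) hT hf1 hΞb ht
  have hsub : Ioc 0 t ⊆ Ioo 0 T := fun s hs => ⟨hs.1, hs.2.trans_lt ht.2⟩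
  have hint : ENNReal.ofReal (∫ s in (0 : ℝ)..t, ‖f s‖) ≤ ∫⁻ s in Ioo 0 T, ‖f s‖ₑ := by
    rw [intervalIntegral.integral_of_le ht.1.le,
      ofReal_integral_norm_eq_lintegral_enorm (hf1.mono_set hsub)]
    exact lintegral_mono_set hsub
  calc ‖Ξ t‖ₑ = ENNReal.ofReal ‖Ξ t‖ := (ofReal_norm _).symm
    _ ≤ ENNReal.ofReal (√M * (‖g₀‖ + ∫ s in (0 : ℝ)..t, ‖f s‖)) := ENNReal.ofReal_le_ofReal hle
    _ = NNReal.sqrt M * (‖g₀‖ₑ + ENNReal.ofReal (∫ s in (0 : ℝ)..t, ‖f s‖)) := by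
        rw [ENNReal.ofReal_mul (Real.sqrt_nonneg _), ENNReal.ofReal_add (norm_nonneg _)
          (intervalIntegral.integral_nonneg_of_forall ht.1.le fun _ => norm_nonneg _),
          ofReal_norm, ← Real.coe_sqrt, ENNReal.ofReal_coe_nnreal]
    _ ≤ NNReal.sqrt M * (‖g₀‖ₑ +
          NNReal.sqrt T.toNNReal * eLpNorm f 2 (volume.restrict (Ioo 0 T))) := by
        gcongr
        exact hint.trans hL1
    _ = _ := by
        push_cast
        ring
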